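/- Let $q\ge 1$, $N\ge 2$, and let $f_1,\dots,f_N:\mathbb R^q\to\mathbb R^q$ be contractive similitudes with contraction ratios $s_1,\dots,s_N\in(0,1)$, i.e. $|f_i(x)-f_i(y)|=s_i|x-y|$ for all $x,y$. Assume the open set condition: there is a non-empty open set $U\subset\mathbb R^q$ with $f_i(U)\subset U$ for all $i$ and $f_i(U)\cap f_j(U)=\emptyset$ for all $i\ne j$. Let $(t_i)_{i=1}^N$ be a probability vector with all $t_i>0$, and let $\nu$ be the associated self-similar measure, i.e. the Borel probability measure on $\mathbb R^q$ with $\nu=\sum_{i=1}^N t_i\,\nu\circ f_i^{-1}$. Let $(p_i)_{i=0}^N$ be a probability vector with all $p_i>0$, and let $\mu$ be the in-homogeneous self-similar measure, i.e. the Borel probability measure with $\mu=p_0\nu+\sum_{i=1}^N p_i\,\mu\circ f_i^{-1}$. For $r>0$ and $n\ge1$ put $$e_{n,r}(\mu)=\inf\Big\{\Big(\int d(x,\alpha)^r\,d\mu(x)\Big)^{1/r}:\ \alpha\subset\mathbb R^q,\ 1\le\operatorname{card}(\alpha)\le n\Big\},$$ where $d(x,\alpha)$ is the Euclidean distance from $x$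 to $\alpha$. The upper and lower quantization dimensions $\overline D_r(\mu)$, $\underline D_r(\mu)$ of order $r$ are the $\limsup$ and $\liminf$, as $n\to\infty$, of $\frac{\log n}{-\log e_{n,r}(\mu)}$; if they agree, the common value is the quantization dimension $D_r(\mu)$. For $s>0$ the upper and lower $s$-dimensional quantization coefficients $\overline Q^s_r(\mu)$, $\underline Q^s_r(\mu)$ are the $\limsup$ and $\liminf$, as $n\to\infty$, of $n^{1/s}e_{n,r}(\mu)$. Then for every $r>0$ there are unique positive reals $\xi_{1,r}$ and $\xi_{2,r}$ with $$\sum_{i=1}^N(t_is_i^r)^{\frac{\xi_{1,r}}{\xi_{1,r}+r}}=1,\qquad \sum_{i=1}^N(p_is_i^r)^{\frac{\xi_{2,r}}{\xi_{2,r}+r}}=1,$$ and, with $\xi_r:=\max\{\xi_{1,r},\xi_{2,r}\}$, the quantization dimension $D_r(\mu)$ exists and equals $\xi_r$, and $\underline Q_r^{\xi_r}(\mu)>0$. Moreover: (a) if $\xi_{1,r}>\xi_{2,r}$, then $\overline Q_r^{\xi_r}(\mu)<\infty$; (b) if $\xi_{1,r}=\xi_{2,r}$, then $\underline Q_r^{\xi_r}(\mu)=\infty$.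 -/

import Mathlib

open MeasureTheory Filter
open scoped ENNReal

noncomputable section

/-- `f` is a contractive similitude with contraction ratio `s ∈ (0, 1)`. -/
def IsContractiveSimilitude {X : Type*} [MetricSpace X] (f : X → X) (s : ℝ) : Prop :=
  0 < s ∧ s < 1 ∧ ∀ x y, dist (f x) (f y) = s * dist x y

/-- The open set condition for a family of maps. -/
def OpenSetCondition {X ι : Type*} [TopologicalSpace X] (f : ι → X → X) : Prop :=
  ∃ U : Set X, IsOpen U ∧ U.Nonempty ∧ (∀ i, f i '' U ⊆ U) ∧
    ∀ i j, i ≠ j → Disjoint (f i '' U) (f j '' U)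

/-- `ν` is a self-similar probability measure associated with the maps `f i` and the weights
`t i`: a Borel probability measure with `ν = ∑ i, t i • (ν ∘ (f i)⁻¹)`. -/
def IsSelfSimilarMeasure {X ι : Type*} [MeasurableSpace X] [Fintype ι]
    (f : ι → X → X) (t : ι → ℝ) (ν : Measure X) : Prop :=
  IsProbabilityMeasure ν ∧ ν = ∑ i, ENNReal.ofReal (t i) • ν.map (f i)

/-- `μ` is an in-homogeneous self-similar probability measure for the condensation system
`(f, (p₀, p), ν)`: a Borel probability measure with
`μ = p₀ • ν + ∑ i, p i • (μ ∘ (f i)⁻¹)`. -/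
def IsInhomogeneousSelfSimilarMeasure {X ι : Type*} [MeasurableSpace X] [Fintype ι]
    (f : ι → X → X) (p₀ : ℝ) (p : ι → ℝ) (ν μ : Measure X) : Prop :=
  IsProbabilityMeasure μ ∧
    μ = ENNReal.ofReal p₀ • ν + ∑ i, ENNReal.ofReal (p i) • μ.map (f i)

/-- The `n`-th quantization error of order `r > 0`: the infimum of `(∫ d(x, α) ^ r dP) ^ (1 / r)`
over all `α` with `1 ≤ card α ≤ n`. -/
def quantizationError {X : Type*} [MetricSpace X] [MeasurableSpace X]
    (P : Measure X) (r : ℝ) (n : ℕ) : ℝ≥0∞ :=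
  ⨅ (α : Finset X) (_ : 1 ≤ α.card ∧ α.card ≤ n),
    (∫⁻ x, Metric.infEDist x (α : Set X) ^ r ∂P) ^ (1 / r)

/-- The upper quantization dimension of order `r`. The logarithm is extended by
`log 0 = -∞`, `log ∞ = ∞`. -/
def upperQuantizationDim {X : Type*} [MetricSpace X] [MeasurableSpace X]
    (P : Measure X) (r : ℝ) : EReal :=
  limsup (fun n : ℕ => ENNReal.log (n : ℝ≥0∞) / (-ENNReal.log (quantizationError P r n))) atTop

/-- The lower quantization dimension of order `r`. -/
def lowerQuantizationDim {X : Type*} [MetricSpace X] [MeasurableSpace X]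
    (P : Measure X) (r : ℝ) : EReal :=
  liminf (fun n : ℕ => ENNReal.log (n : ℝ≥0∞) / (-ENNReal.log (quantizationError P r n))) atTop

/-- The quantization dimension of order `r` exists and equals `D`. -/
def HasQuantizationDim {X : Type*} [MetricSpace X] [MeasurableSpace X]
    (P : Measure X) (r D : ℝ) : Prop :=
  upperQuantizationDim P r = (D : EReal) ∧ lowerQuantizationDim P r = (D : EReal)

/-- The `s`-dimensional upper quantization coefficient of order `r`. -/
def upperQuantizationCoeff {X : Type*} [MetricSpace X] [MeasurableSpace X]
    (P : Measure X) (r s : ℝ) : ℝ≥0∞ :=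
  limsup (fun n : ℕ => (n : ℝ≥0∞) ^ (1 / s) * quantizationError P r n) atTop

/-- The `s`-dimensional lower quantization coefficient of order `r`. -/
def lowerQuantizationCoeff {X : Type*} [MetricSpace X] [MeasurableSpace X]
    (P : Measure X) (r s : ℝ) : ℝ≥0∞ :=
  liminf (fun n : ℕ => (n : ℝ≥0∞) ^ (1 / s) * quantizationError P r n) atTop

/-- `ξ` is a positive solution of `∑ i, (w i * s i ^ r) ^ (ξ / (ξ + r)) = 1`. -/
def IsQuantizationExponent {ι : Type*} [Fintype ι] (s w : ι → ℝ) (r ξ : ℝ) : Prop :=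
  0 < ξ ∧ ∑ i, (w i * s i ^ r) ^ (ξ / (ξ + r)) = 1

end

/-! Put `u = ξ / (ξ + r)`, write `s_σ` and `f_σ` for the contraction ratio and the map of a word
`σ`, and let `c σ = m σ * s_σ ^ r` when a mass `m σ` sits on the cylinder of `σ`. Cutting the tree
of words where `c` falls below `ε` gives pieces of comparable cost. If the sum of the `c σ ^ u` over
such a cut is about `L`, there are about `L * ε ^ (-u)` pieces and the error is about `L * ε ^ (1 -
u)`. With `n` points this is of order `n ^ (-(r / ξ))`, because `(1 - u) / u = r / ξ`.

Lower bounds. Under the open set condition there are a word `J` and a set `B = f_J(A)` such that the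
sets `f_σ(B)` of incomparable words lie at distance at least `δ * max s_σ s_τ`
(`exists_separating_word`, by maximizing a number of neighbours). Hence one point can serve only one
word of an antichain, and among `2n` words at least `n` are badly served
(`le_lintegral_infEDist_of_isSeparatingSet`). Stopping at a suitable threshold yields
`eventually_le_quantizationError`, whose constant grows with `L`. The masses `p₀ * t_σ` carried by
`ν` and `p_σ` carried by `μ` give positivity at both exponents, hence at the larger one.

If the exponents agree, the `ν`-mass that reaches a word of length `k` in the iterated equation is a
sum of `k + 1` terms, one for each way of taking first `p`-weights and then `t`-weights. The `u`-th
powers of each kind of term have a fixed total over level `k`, and concavity of `x ^ u` gives `L ≥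
p₀ ^ u * (k + 1) ^ u`. As `k` is arbitrary, the lower coefficient is infinite.

Upper bounds. Images of good finite sets under the `f i` are good for the image measures. For `ν`
the bounds reproduce themselves from scale to scale as soon as `∑ i, (t i * s i ^ r) ^ u ≤ 1`. For
`μ` the strict inequality `∑ i, (p i * s i ^ r) ^ u < 1` leaves a fixed share of the points for `ν`.
At `ξ₁ > ξ₂` both conditions hold, which is (a); in general they hold at every `η > max ξ₁ ξ₂`,
which is enough for the dimension. -/

/-! ### Words

A word is a list with its innermost letter at the head, so that the children of `σ` are the words
`i :: σ` and the ancestors of `σ` are its suffixes. -/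

section Words

variable {X ι : Type*}

/-- The composition of the maps `f i` along a word. -/
def wordMap (f : ι → X → X) : List ι → X → X
  | [] => id
  | i :: σ => fun x => wordMap f σ (f i x)

/-- The product of the weights `w i` along a word. -/
noncomputable def wordWeight (w : ι → ℝ) (σ : List ι) : ℝ := (σ.map w).prod

@[simp] lemma wordMap_nil (f : ι → X → X) (x : X) : wordMap f [] x = x := rfl

@[simp] lemma wordMap_cons (f : ι → X → X) (i : ι) (σ : List ι) (x : X) :
    wordMap f (i :: σ) x = wordMap f σ (f i x) := rfl

lemma wordMap_append (f : ι → X → X) (τ σ : List ι) (x : X) :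
    wordMap f (τ ++ σ) x = wordMap f σ (wordMap f τ x) := by
  induction τ generalizing x with
  | nil => rfl
  | cons i τ ih => simp [ih]

@[simp] lemma wordWeight_nil (w : ι → ℝ) : wordWeight w [] = 1 := by simp [wordWeight]

@[simp] lemma wordWeight_cons (w : ι → ℝ) (i : ι) (σ : List ι) :
    wordWeight w (i :: σ) = w i * wordWeight w σ := by simp [wordWeight]

lemma wordWeight_append (w : ι → ℝ) (τ σ : List ι) :
    wordWeight w (τ ++ σ) = wordWeight w τ * wordWeight w σ := by simp [wordWeight]

lemma wordWeight_pos {w : ι → ℝ} (hw : ∀ i, 0 < w i) (σ : List ι) : 0 < wordWeight w σ := by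
  induction σ with
  | nil => simp
  | cons i σ ih => simpa using mul_pos (hw i) ih

lemma wordWeight_le_pow {w : ι → ℝ} (hw : ∀ i, 0 < w i) {θ : ℝ} (hθ : ∀ i, w i ≤ θ)
    (σ : List ι) : wordWeight w σ ≤ θ ^ σ.length := by
  induction σ with
  | nil => simp
  | cons i σ ih =>
    rw [wordWeight_cons, List.length_cons, pow_succ']
    exact mul_le_mul (hθ i) ih (wordWeight_pos hw σ).le ((hw i).le.trans (hθ i))

lemma wordWeight_le_one {w : ι → ℝ} (hw : ∀ i, 0 < w i) (hw1 : ∀ i, w i ≤ 1) (σ : List ι) :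
    wordWeight w σ ≤ 1 := by
  simpa using wordWeight_le_pow hw hw1 σ

lemma wordWeight_mul (v w : ι → ℝ) (σ : List ι) :
    wordWeight (fun i => v i * w i) σ = wordWeight v σ * wordWeight w σ := by
  induction σ with
  | nil => simp
  | cons i σ ih => simp only [wordWeight_cons, ih]; ring

lemma wordWeight_rpow {w : ι → ℝ} (hw : ∀ i, 0 < w i) (r : ℝ) (σ : List ι) :
    wordWeight (fun i => w i ^ r) σ = wordWeight w σ ^ r := by
  induction σ with
  | nil => simp
  | cons i σ ih =>
    simp only [wordWeight_cons, ih]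
    rw [Real.mul_rpow (hw i).le (wordWeight_pos hw σ).le]

lemma wordWeight_le_of_suffix {w : ι → ℝ} (hw : ∀ i, 0 < w i) (hw1 : ∀ i, w i ≤ 1)
    {σ τ : List ι} (h : σ <:+ τ) : wordWeight w τ ≤ wordWeight w σ := by
  obtain ⟨κ, rfl⟩ := h
  rw [wordWeight_append]
  exact mul_le_of_le_one_left (wordWeight_pos hw σ).le (wordWeight_le_one hw hw1 κ)

lemma dist_wordMap [MetricSpace X] {f : ι → X → X} {s : ι → ℝ}
    (hf : ∀ i x y, dist (f i x) (f i y) = s i * dist x y) (σ : List ι) (x y : X) :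
    dist (wordMap f σ x) (wordMap f σ y) = wordWeight s σ * dist x y := by
  induction σ generalizing x y with
  | nil => simp
  | cons i σ ih => simp only [wordMap_cons, wordWeight_cons, ih, hf]; ring

lemma wordMap_injective {f : ι → X → X} (hf : ∀ i, Function.Injective (f i)) (σ : List ι) :
    Function.Injective (wordMap f σ) := by
  induction σ with
  | nil => exact Function.injective_id
  | cons i σ ih => exact ih.comp (hf i)

lemma wordMap_surjective {f : ι → X → X} (hf : ∀ i, Function.Surjective (f i)) (σ : List ι) :
    Function.Surjective (wordMap f σ) := by
  induction σ with
  | nil => exact Function.surjective_id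
  | cons i σ ih => exact ih.comp (hf i)

lemma wordMap_mem {f : ι → X → X} {A : Set X} (hA : ∀ i, ∀ x ∈ A, f i x ∈ A) (σ : List ι)
    {x : X} (hx : x ∈ A) : wordMap f σ x ∈ A := by
  induction σ generalizing x with
  | nil => exact hx
  | cons i σ ih => exact ih (hA i x hx)

lemma measurable_wordMap [MeasurableSpace X] {f : ι → X → X} (hf : ∀ i, Measurable (f i))
    (σ : List ι) : Measurable (wordMap f σ) := by
  induction σ with
  | nil => exact measurable_id
  | cons i σ ih => exact ih.comp (hf i)

lemma exists_branch_of_not_prefix : ∀ σ τ : List ι, ¬ σ <+: τ → ¬ τ <+: σ →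
    ∃ (κ : List ι) (i j : ι) (σ' τ' : List ι), i ≠ j ∧ σ = κ ++ i :: σ' ∧ τ = κ ++ j :: τ'
  | [], _, h, _ => absurd List.nil_prefix h
  | _ :: _, [], _, h => absurd List.nil_prefix h
  | i :: σ, j :: τ, h, h' => by
    by_cases hij : i = j
    · subst hij
      rw [List.cons_prefix_cons] at h h'
      obtain ⟨κ, i', j', σ', τ', hne, rfl, rfl⟩ :=
        exists_branch_of_not_prefix σ τ (fun hh => h ⟨rfl, hh⟩) (fun hh => h' ⟨rfl, hh⟩)
      exact ⟨i :: κ, i', j', σ', τ', hne, rfl, rfl⟩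
    · exact ⟨[], i, j, σ, τ, hij, rfl, rfl⟩

lemma exists_branch_of_not_suffix {σ τ : List ι} (h : ¬ σ <:+ τ) (h' : ¬ τ <:+ σ) :
    ∃ (κ : List ι) (i j : ι) (σ' τ' : List ι), i ≠ j ∧ σ = σ' ++ i :: κ ∧ τ = τ' ++ j :: κ := by
  obtain ⟨κ, i, j, σ', τ', hne, h1, h2⟩ := exists_branch_of_not_prefix σ.reverse τ.reverse
    (by rwa [List.reverse_prefix]) (by rwa [List.reverse_prefix])
  refine ⟨κ.reverse, i, j, σ'.reverse, τ'.reverse, hne, ?_, ?_⟩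
  · simpa using congrArg List.reverse h1
  · simpa using congrArg List.reverse h2

lemma disjoint_wordMap_image {f : ι → X → X} (hf : ∀ i, Function.Injective (f i)) {U : Set X}
    (hU : ∀ i, ∀ x ∈ U, f i x ∈ U) (hd : ∀ i j, i ≠ j → Disjoint (f i '' U) (f j '' U))
    {σ τ : List ι} (h : ¬ σ <:+ τ) (h' : ¬ τ <:+ σ) :
    Disjoint (wordMap f σ '' U) (wordMap f τ '' U) := by
  obtain ⟨κ, i, j, σ', τ', hne, rfl, rfl⟩ := exists_branch_of_not_suffix h h'
  rw [Set.disjoint_left]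
  rintro _ ⟨x, hx, rfl⟩ ⟨y, hy, hxy⟩
  simp only [wordMap_append, wordMap_cons] at hxy
  have := wordMap_injective hf κ hxy
  exact (Set.disjoint_left.1 (hd i j hne)) ⟨_, wordMap_mem hU σ' hx, rfl⟩
    ⟨_, wordMap_mem hU τ' hy, this⟩

/-- A set of words none of which is a proper ancestor of another. -/
def IsWordAntichain (Γ : Finset (List ι)) : Prop :=
  ∀ σ ∈ Γ, ∀ τ ∈ Γ, σ <:+ τ → σ = τ

lemma isWordAntichain_singleton (σ : List ι) : IsWordAntichain {σ} := by
  intro x hx y hy _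
  rw [Finset.mem_singleton.1 hx, Finset.mem_singleton.1 hy]

variable [Fintype ι]

open scoped Classical in
/-- Replace each word satisfying `P` by its children. -/
noncomputable def splitWords (P : List ι → Prop) (Γ : Finset (List ι)) : Finset (List ι) :=
  Γ.biUnion fun σ => if P σ then Finset.univ.image (fun i => i :: σ) else {σ}

lemma mem_splitWords {P : List ι → Prop} {Γ : Finset (List ι)} {τ : List ι} :
    τ ∈ splitWords P Γ ↔ (τ ∈ Γ ∧ ¬ P τ) ∨ ∃ i, ∃ σ ∈ Γ, P σ ∧ τ = i :: σ := by
  classical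
  simp only [splitWords, Finset.mem_biUnion]
  constructor
  · rintro ⟨σ, hσ, h⟩
    split_ifs at h with hP
    · obtain ⟨i, -, rfl⟩ := Finset.mem_image.1 h
      exact Or.inr ⟨i, σ, hσ, hP, rfl⟩
    · rw [Finset.mem_singleton.1 h]
      exact Or.inl ⟨hσ, hP⟩
  · rintro (⟨h, hP⟩ | ⟨i, σ, hσ, hP, rfl⟩)
    · exact ⟨τ, h, by simp [hP]⟩
    · exact ⟨σ, hσ, by simp [hP]⟩

lemma IsWordAntichain.splitWords {Γ : Finset (List ι)} (h : IsWordAntichain Γ)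
    (P : List ι → Prop) : IsWordAntichain (splitWords P Γ) := by
  intro x hx y hy hxy
  have len : ∀ (i : ι) (σ : List ι), i :: σ ≠ σ := fun i σ => by simp
  rcases mem_splitWords.1 hx with ⟨hx, hPx⟩ | ⟨i, σ, hσ, hPσ, rfl⟩ <;>
    rcases mem_splitWords.1 hy with ⟨hy, hPy⟩ | ⟨j, τ, hτ, hPτ, rfl⟩
  · exact h x hx y hy hxy
  · rcases List.suffix_cons_iff.1 hxy with rfl | h'
    · rfl
    · obtain rfl := h x hx τ hτ h'
      exact absurd hPτ hPx
  · obtain rfl := h σ hσ y hy ((List.suffix_cons i σ).trans hxy)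
    exact absurd hPσ hPy
  · rcases List.suffix_cons_iff.1 hxy with h' | h'
    · exact h'
    · obtain rfl := h σ hσ τ hτ ((List.suffix_cons i σ).trans h')
      exact absurd (h'.length_le) (by simp)

/-- The antichain property makes the pieces disjoint: a child of one member is never another member.
-/
lemma sum_splitWords {M : Type*} [AddCommMonoid M] {Γ : Finset (List ι)} (h : IsWordAntichain Γ)
    (P : List ι → Prop) [DecidablePred P] (g : List ι → M) :
    ∑ σ ∈ splitWords P Γ, g σ = ∑ σ ∈ Γ, if P σ then ∑ i, g (i :: σ) else g σ := by
  classical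
  rw [splitWords, Finset.sum_biUnion]
  · refine Finset.sum_congr rfl fun σ _ => ?_
    by_cases hP : P σ
    · simp only [hP, if_true]
      rw [Finset.sum_image]
      intro i _ j _ hij
      simpa using hij
    · simp [hP]
  · intro σ hσ τ hτ hne
    rw [Function.onFun, Finset.disjoint_left]
    intro x hx hy
    have key : ∀ ρ : List ι, (x ∈ if P ρ then Finset.univ.image (fun i => i :: ρ) else {ρ}) →
        x = ρ ∨ ∃ i, x = i :: ρ := by
      intro ρ hρ
      split_ifs at hρ
      · obtain ⟨i, -, rfl⟩ := Finset.mem_image.1 hρ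
        exact Or.inr ⟨i, rfl⟩
      · exact Or.inl (Finset.mem_singleton.1 hρ)
    rcases key σ (by convert hx) with rfl | ⟨i, rfl⟩
    · rcases key τ (by convert hy) with rfl | ⟨j, rfl⟩
      · exact hne rfl
      · exact hne (h τ hτ _ hσ (List.suffix_cons j τ)).symm
    · rcases key τ (by convert hy) with rfl | ⟨j, hj⟩
      · exact hne (h σ hσ _ hτ (List.suffix_cons i σ))
      · exact hne (List.cons.inj hj).2

/-- `Γ'` arises from `Γ` by repeatedly replacing words by their children. -/
def IsRefinement (Γ Γ' : Finset (List ι)) : Prop :=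
  Relation.ReflTransGen (fun Γ₁ Γ₂ => ∃ P : List ι → Prop, Γ₂ = splitWords P Γ₁) Γ Γ'

lemma IsRefinement.isWordAntichain {Γ Γ' : Finset (List ι)} (h : IsRefinement Γ Γ')
    (hΓ : IsWordAntichain Γ) : IsWordAntichain Γ' := by
  induction h with
  | refl => exact hΓ
  | tail _ h ih => obtain ⟨P, rfl⟩ := h; exact ih.splitWords P

lemma IsRefinement.sum_le {M : Type*} [AddCommMonoid M] [PartialOrder M] [IsOrderedAddMonoid M]
    {Γ Γ' : Finset (List ι)} (h : IsRefinement Γ Γ') (hΓ : IsWordAntichain Γ) {g : List ι → M}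
    (hg : ∀ σ, g σ ≤ ∑ i, g (i :: σ)) : ∑ σ ∈ Γ, g σ ≤ ∑ σ ∈ Γ', g σ := by
  classical
  induction h with
  | refl => exact le_rfl
  | tail h1 h ih =>
    obtain ⟨P, rfl⟩ := h
    refine ih.trans ?_
    rw [sum_splitWords (IsRefinement.isWordAntichain h1 hΓ) P]
    refine Finset.sum_le_sum fun σ _ => ?_
    split_ifs
    · exact hg σ
    · exact le_rfl

lemma IsRefinement.sum_ge {M : Type*} [AddCommMonoid M] [PartialOrder M] [IsOrderedAddMonoid M]
    {Γ Γ' : Finset (List ι)} (h : IsRefinement Γ Γ') (hΓ : IsWordAntichain Γ) {g : List ι → M}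
    (hg : ∀ σ, ∑ i, g (i :: σ) ≤ g σ) : ∑ σ ∈ Γ', g σ ≤ ∑ σ ∈ Γ, g σ :=
  IsRefinement.sum_le (M := Mᵒᵈ) h hΓ hg

/-- Refining until a positive function `c`, decaying along words, falls below a threshold. -/
lemma exists_refinement_threshold {c : List ι → ℝ} {κ ε : ℝ} (hκ0 : 0 ≤ κ)
    (hκ : ∀ i σ, κ * c σ ≤ c (i :: σ)) (hdec : ∃ K : ℕ, ∀ σ, K ≤ σ.length → c σ < ε)
    {Γ : Finset (List ι)} (hΓ : ∀ σ ∈ Γ, ε ≤ c σ) :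
    ∃ Γ', IsRefinement Γ Γ' ∧ ∀ σ ∈ Γ', κ * ε ≤ c σ ∧ c σ < ε := by
  -- After `K` rounds of splitting, every word that has not yet stopped has length at least `K`; the
  -- decay of `c` rules such words out for large `K`.
  have key : ∀ K : ℕ, ∃ Γ', IsRefinement Γ Γ' ∧
      ∀ σ ∈ Γ', (κ * ε ≤ c σ ∧ c σ < ε) ∨ (ε ≤ c σ ∧ K ≤ σ.length) := by
    intro K
    induction K with
    | zero => exact ⟨Γ, Relation.ReflTransGen.refl, fun σ hσ => Or.inr ⟨hΓ σ hσ, Nat.zero_le _⟩⟩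
    | succ K ih =>
      obtain ⟨Γ', h1, h2⟩ := ih
      refine ⟨splitWords (fun σ => ε ≤ c σ) Γ', h1.tail ⟨_, rfl⟩, fun τ hτ => ?_⟩
      rcases mem_splitWords.1 hτ with ⟨h3, h4⟩ | ⟨i, σ, hσ, h3, rfl⟩
      · rcases h2 τ h3 with h5 | h5
        · exact Or.inl h5
        · exact absurd h5.1 h4
      · rcases h2 σ hσ with h5 | h5
        · exact absurd h3 (not_le.2 h5.2)
        · rcases lt_or_ge (c (i :: σ)) ε with h6 | h6
          · exact Or.inl ⟨(mul_le_mul_of_nonneg_left h3 hκ0).trans (hκ i σ), h6⟩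
          · exact Or.inr ⟨h6, by simpa using h5.2⟩
  obtain ⟨K, hK⟩ := hdec
  obtain ⟨Γ', h1, h2⟩ := key K
  refine ⟨Γ', h1, fun σ hσ => ?_⟩
  rcases h2 σ hσ with h | h
  · exact h
  · exact absurd (hK σ h.2) (not_lt.2 h.1)

/-- The words of length `k`. -/
noncomputable def levelWords (ι : Type*) [Fintype ι] : ℕ → Finset (List ι)
  | 0 => {[]}
  | k + 1 => splitWords (fun _ => True) (levelWords ι k)

lemma isRefinement_levelWords (k : ℕ) : IsRefinement {[]} (levelWords ι k) := by
  induction k with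
  | zero => exact Relation.ReflTransGen.refl
  | succ k ih => exact ih.tail ⟨_, rfl⟩

lemma isWordAntichain_levelWords (k : ℕ) : IsWordAntichain (levelWords ι k) :=
  (isRefinement_levelWords k).isWordAntichain (isWordAntichain_singleton _)

lemma length_of_mem_levelWords {k : ℕ} {σ : List ι} (h : σ ∈ levelWords ι k) :
    σ.length = k := by
  induction k generalizing σ with
  | zero => simpa [levelWords] using h
  | succ k ih =>
    rcases mem_splitWords.1 h with ⟨-, h⟩ | ⟨i, τ, hτ, -, rfl⟩
    · exact absurd trivial h
    · simp [ih hτ]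

lemma sum_levelWords_succ {M : Type*} [AddCommMonoid M] (k : ℕ) (g : List ι → M) :
    ∑ σ ∈ levelWords ι (k + 1), g σ = ∑ σ ∈ levelWords ι k, ∑ i, g (i :: σ) := by
  classical
  rw [levelWords, sum_splitWords (isWordAntichain_levelWords k)]
  simp

end Words

/-! ### Separation of cylinders under the open set condition -/

section Separation

variable {ι E : Type*} [NormedAddCommGroup E] [InnerProductSpace ℝ E] [FiniteDimensional ℝ E]

/-- After rescaling, `g` is an isometry into a strictly convex space, hence affine, and an affine
isometry of a finite-dimensional space into itself is onto. Surjectivity makes the image of a ball a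
full ball, which the packing argument below needs. -/
lemma surjective_of_dist_eq {g : E → E} {s : ℝ} (hs : 0 < s)
    (hg : ∀ x y, dist (g x) (g y) = s * dist x y) : Function.Surjective g := by
  have hiso : Isometry fun x => s⁻¹ • g x := by
    refine Isometry.of_dist_eq fun x y => ?_
    rw [dist_smul₀, hg, Real.norm_eq_abs, abs_of_pos (inv_pos.2 hs), ← mul_assoc,
      inv_mul_cancel₀ hs.ne', one_mul]
  have : Inhabited E := ⟨0⟩
  have hsurj : Function.Surjective hiso.affineIsometryOfStrictConvexSpace := by
    have h := (hiso.affineIsometryOfStrictConvexSpace.toAffineIsometryEquiv rfl).surjective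
    simpa using h
  intro y
  obtain ⟨x, hx⟩ := hsurj (s⁻¹ • y)
  refine ⟨x, ?_⟩
  simp only [Isometry.coe_affineIsometryOfStrictConvexSpace] at hx
  exact smul_right_injective E (inv_pos.2 hs).ne' hx

/-- Uniform bound on the cardinality of separated families in a ball. -/
lemma exists_card_le_of_separated {R η : ℝ} (hη : 0 < η) :
    ∃ M : ℕ, ∀ {β : Type*} (F : Finset β) (z : β → E), (∀ b ∈ F, ‖z b‖ ≤ R) →
      (∀ b ∈ F, ∀ b' ∈ F, b ≠ b' → η ≤ dist (z b) (z b')) → F.card ≤ M := by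
  classical
  obtain ⟨t, -, htf, ht⟩ := Metric.totallyBounded_iff.1
    (isCompact_closedBall (0 : E) R).totallyBounded (η / 2) (by positivity) |>.imp
      fun t h => (⟨trivial, h.1, h.2⟩ : True ∧ _ ∧ _)
  refine ⟨htf.toFinset.card, fun {β} F z hz hsep => ?_⟩
  have hex : ∀ b ∈ F, ∃ y ∈ t, dist (z b) y < η / 2 := by
    intro b hb
    have := ht (mem_closedBall_zero_iff.2 (hz b hb))
    simpa using this
  choose! y hy hy' using hex
  refine Finset.card_le_card_of_injOn y (fun b hb => by simpa using hy b hb) ?_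
  intro b hb b' hb' hbb
  by_contra hne
  have h1 := hsep b hb b' hb' hne
  have h2 := dist_triangle_right (z b) (z b') (y b)
  have h3 := hy' b hb
  have h4 := hy' b' hb'
  rw [← hbb] at h4
  linarith

/-- The words of size comparable to `σ` whose cylinder is close to that of `σ`. -/
def wordNeighbours (f : ι → E → E) (s : ι → ℝ) (A : Set E) (σ : List ι) : Set (List ι) :=
  {τ | τ ≠ [] ∧ wordWeight s τ ≤ wordWeight s σ ∧ wordWeight s σ < wordWeight s τ.tail ∧
    ∃ x ∈ A, ∃ y ∈ A, dist (wordMap f σ x) (wordMap f τ y) < wordWeight s σ}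

/-- A proper suffix of `τ` is a suffix of `τ.tail`, so its ratio still exceeds `b`. Thus different
words stopped at the same threshold are incomparable. -/
lemma eq_of_suffix_of_stopped {s : ι → ℝ} (hs : ∀ i, 0 < s i) (hs1 : ∀ i, s i ≤ 1) {b : ℝ}
    {σ τ : List ι} (hσ : wordWeight s σ ≤ b) (hτ : b < wordWeight s τ.tail) (h : σ <:+ τ) :
    σ = τ := by
  cases τ with
  | nil => simpa using h
  | cons i τ =>
    rcases List.suffix_cons_iff.1 h with h | h
    · exact h
    · have := wordWeight_le_of_suffix hs hs1 h
      simp only [List.tail_cons] at hτ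
      linarith

lemma exists_stopped_suffix {s : ι → ℝ} {b : ℝ} (hb : b < 1) :
    ∀ τ : List ι, wordWeight s τ ≤ b →
      ∃ τ', τ' <:+ τ ∧ τ' ≠ [] ∧ wordWeight s τ' ≤ b ∧ b < wordWeight s τ'.tail
  | [], h => by simp at h; linarith
  | i :: τ, h => by
    rcases le_or_gt (wordWeight s τ) b with h' | h'
    · obtain ⟨τ', h1, h2⟩ := exists_stopped_suffix hb τ h'
      exact ⟨τ', h1.trans (List.suffix_cons i τ), h2⟩
    · exact ⟨i :: τ, List.suffix_rfl, by simp, h, by simpa using h'⟩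

/-- A packing argument. Fix a ball of radius `ρ` about `z` inside `U`. Neighbours of `σ` are
pairwise incomparable, so the images of `U` under them are disjoint, and each contains a ball of
radius at least `smin * ρ` times the ratio of `σ`. Rescaled by that ratio, the centres are separated
points in a fixed ball. -/
lemma exists_card_wordNeighbours_le [Finite ι] {f : ι → E → E} {s : ι → ℝ}
    (hf : ∀ i, IsContractiveSimilitude (f i) (s i)) (hOSC : OpenSetCondition f)
    {A : Set E} (hA : Bornology.IsBounded A) :
    ∃ M : ℕ, ∀ σ, ∀ F : Finset (List ι), (F : Set (List ι)) ⊆ wordNeighbours f s A σ →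
      F.card ≤ M := by
  have hs : ∀ i, 0 < s i := fun i => (hf i).1
  have hs1 : ∀ i, s i ≤ 1 := fun i => (hf i).2.1.le
  have hd := dist_wordMap (fun i => (hf i).2.2)
  have hsurj := wordMap_surjective (fun i => surjective_of_dist_eq (hs i) (hf i).2.2)
  have hinj : ∀ i, Function.Injective (f i) := fun i x y hxy => by
    have := (hf i).2.2 x y
    rw [hxy, dist_self] at this
    rcases mul_eq_zero.1 this.symm with h | h
    · exact absurd h (hs i).ne'
    · exact dist_eq_zero.1 h
  obtain ⟨U, hUo, ⟨z, hz⟩, hU, hdis⟩ := hOSC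
  obtain ⟨ρ, hρ, hball⟩ := Metric.isOpen_iff.1 hUo z hz
  obtain ⟨smin, hsmin, hsm⟩ : ∃ m : ℝ, 0 < m ∧ ∀ i, m ≤ s i := by
    cases isEmpty_or_nonempty ι
    · exact ⟨1, one_pos, fun i => isEmptyElim i⟩
    · obtain ⟨i, hi⟩ := Finite.exists_min s
      exact ⟨s i, hs i, hi⟩
  obtain ⟨D, hD⟩ := hA.subset_closedBall z
  obtain ⟨M, hM⟩ := exists_card_le_of_separated (E := E) (R := 1 + 2 * D) (mul_pos hsmin hρ)
  refine ⟨M, fun σ F hF => ?_⟩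
  have hσ := wordWeight_pos hs σ
  have hlow : ∀ τ ∈ F, smin * wordWeight s σ ≤ wordWeight s τ := by
    intro τ hτ
    obtain ⟨h1, -, h3, -⟩ := hF hτ
    cases τ with
    | nil => exact absurd rfl h1
    | cons i τ =>
      rw [wordWeight_cons]
      exact mul_le_mul (hsm i) h3.le hσ.le (hs i).le
  refine hM F (fun τ => (wordWeight s σ)⁻¹ • (wordMap f τ z - wordMap f σ z)) ?_ ?_
  · intro τ hτ
    obtain ⟨-, h2, -, x, hx, y, hy, hxy⟩ := hF hτ
    have hx' : dist x z ≤ D := hD hx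
    have hy' : dist y z ≤ D := hD hy
    have hD0 : 0 ≤ D := dist_nonneg.trans hx'
    rw [norm_smul, Real.norm_eq_abs, abs_of_pos (inv_pos.2 hσ), ← dist_eq_norm,
      inv_mul_le_iff₀ hσ]
    have h4 := dist_triangle4 (wordMap f τ z) (wordMap f τ y) (wordMap f σ x) (wordMap f σ z)
    rw [hd, hd, dist_comm z y, dist_comm (wordMap f τ y)] at h4
    nlinarith [mul_le_mul h2 hy' dist_nonneg hσ.le, mul_le_mul_of_nonneg_left hx' hσ.le]
  · intro τ hτ τ' hτ' hne
    obtain ⟨-, h2, h3, -⟩ := hF hτ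
    obtain ⟨-, h2', h3', -⟩ := hF hτ'
    have hdisj := disjoint_wordMap_image hinj (fun i x hx => hU i ⟨x, hx, rfl⟩) hdis
      (fun h => hne (eq_of_suffix_of_stopped hs hs1 h2 h3' h))
      (fun h => hne (eq_of_suffix_of_stopped hs hs1 h2' h3 h).symm)
    rw [dist_smul₀, dist_sub_right, Real.norm_eq_abs, abs_of_pos (inv_pos.2 hσ),
      le_inv_mul_iff₀ hσ]
    -- Were the centres closer, `wordMap f τ' z` would lie in the ball about `wordMap f τ z` that is
    -- contained in the image of `U` under `τ`.
    by_contra! hlt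
    obtain ⟨w, hw⟩ := hsurj τ (wordMap f τ' z)
    have hwU : w ∈ U := by
      refine hball ?_
      rw [← hw, hd, dist_comm] at hlt
      have h5 := mul_le_mul_of_nonneg_right (hlow τ hτ) hρ.le
      have h6 : wordWeight s τ * dist w z < wordWeight s τ * ρ := by nlinarith
      exact lt_of_mul_lt_mul_left h6 (wordWeight_pos hs τ).le
    exact (Set.disjoint_left.1 hdisj) ⟨w, hwU, rfl⟩ ⟨z, hz, hw.symm⟩

/-- The images of `B` under the maps of incomparable words are far apart. -/
def IsSeparatingSet {X ι : Type*} [MetricSpace X] (f : ι → X → X) (s : ι → ℝ) (B : Set X)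
    (δ : ℝ) : Prop :=
  ∀ σ τ, ¬ σ <:+ τ → ¬ τ <:+ σ → ∀ x ∈ B, ∀ y ∈ B,
    δ * max (wordWeight s σ) (wordWeight s τ) ≤ dist (wordMap f σ x) (wordMap f τ y)

/-- Under the open set condition there is a word `J` such that the cylinders of `J ++ σ` and
`J ++ τ` are far apart for all incomparable `σ` and `τ`. -/
lemma exists_separating_word [Finite ι] [Nonempty ι] {f : ι → E → E} {s : ι → ℝ}
    (hf : ∀ i, IsContractiveSimilitude (f i) (s i)) (hOSC : OpenSetCondition f)
    {A : Set E} (hA : Bornology.IsBounded A) (hAf : ∀ i, ∀ x ∈ A, f i x ∈ A) :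
    ∃ J : List ι, ∃ δ : ℝ, 0 < δ ∧ IsSeparatingSet f s (wordMap f J '' A) δ := by
  classical
  have hs : ∀ i, 0 < s i := fun i => (hf i).1
  have hs1 : ∀ i, s i ≤ 1 := fun i => (hf i).2.1.le
  have hd := dist_wordMap (fun i => (hf i).2.2)
  obtain ⟨M, hM⟩ := exists_card_wordNeighbours_le hf hOSC hA
  let S : Set ℕ := {n | ∃ J : List ι, J ≠ [] ∧ ∃ F : Finset (List ι),
    (F : Set (List ι)) ⊆ wordNeighbours f s A J ∧ F.card = n}
  have hSne : S.Nonempty := ⟨0, [Classical.arbitrary ι], by simp, ∅, by simp, rfl⟩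
  have hSbd : BddAbove S := ⟨M, by rintro _ ⟨J, -, F, hF, rfl⟩; exact hM J F hF⟩
  obtain ⟨J, hJ, F, hF, hcard⟩ := Nat.sSup_mem hSne hSbd
  -- Appending `κ` to the neighbours of `J` already produces the maximal number of neighbours of `J
  -- ++ κ`. One that does not end in `κ` would be an additional one.
  have hmax : ∀ κ, ∀ τ ∈ wordNeighbours f s A (J ++ κ), κ <:+ τ := by
    intro κ τ hτ
    by_contra hκ
    let F' : Finset (List ι) := F.image (· ++ κ)
    have hF' : (F' : Set (List ι)) ⊆ wordNeighbours f s A (J ++ κ) := by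
      intro ρ hρ
      obtain ⟨π, hπ, rfl⟩ := Finset.mem_image.1 hρ
      obtain ⟨h1, h2, h3, x, hx, y, hy, hxy⟩ := hF hπ
      have hκ0 := wordWeight_pos hs κ
      refine ⟨by simp [h1], ?_, ?_, x, hx, y, hy, ?_⟩
      · rw [wordWeight_append, wordWeight_append]
        exact mul_le_mul_of_nonneg_right h2 hκ0.le
      · rw [List.tail_append_of_ne_nil h1, wordWeight_append, wordWeight_append]
        exact mul_lt_mul_of_pos_right h3 hκ0
      · rw [wordMap_append, wordMap_append, hd, wordWeight_append, mul_comm]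
        exact mul_lt_mul_of_pos_right hxy hκ0
    have hnot : τ ∉ F' := by
      intro h
      obtain ⟨π, -, rfl⟩ := Finset.mem_image.1 h
      exact hκ (List.suffix_append π κ)
    have hc' : F'.card = F.card := Finset.card_image_of_injective _ (List.append_left_injective κ)
    have hmem : (insert τ F').card ∈ S := ⟨J ++ κ, by simp [hJ], insert τ F', by
      rw [Finset.coe_insert]; exact Set.insert_subset hτ hF', rfl⟩
    have := le_csSup hSbd hmem
    rw [Finset.card_insert_of_notMem hnot, hc', hcard] at this
    omega
  have hJ1 : wordWeight s J < 1 := by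
    cases J with
    | nil => exact absurd rfl hJ
    | cons i J =>
      rw [wordWeight_cons]
      exact mul_lt_one_of_nonneg_of_lt_one_left (hs i).le (hf i).2.1 (wordWeight_le_one hs hs1 J)
  have key : ∀ σ τ, ¬ σ <:+ τ → ¬ τ <:+ σ → wordWeight s τ ≤ wordWeight s σ → ∀ x ∈ A, ∀ y ∈ A,
      wordWeight s J * wordWeight s σ ≤
        dist (wordMap f σ (wordMap f J x)) (wordMap f τ (wordMap f J y)) := by
    intro σ τ h h' hle x hx y hy
    by_contra! hlt
    have hb : wordWeight s (J ++ σ) < 1 := by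
      rw [wordWeight_append]
      exact mul_lt_one_of_nonneg_of_lt_one_left (wordWeight_pos hs J).le hJ1
        (wordWeight_le_one hs hs1 σ)
    -- If the points are too close, cutting `J ++ τ` back to the size of `J ++ σ` gives a neighbour
    -- of `J ++ σ`. By `hmax` it ends in `σ`, so `σ` and `τ` are both suffixes of `J ++ τ` and hence
    -- comparable.
    obtain ⟨τ', ⟨ρ, hρ⟩, h1, h2, h3⟩ := exists_stopped_suffix (s := s) hb (J ++ τ) (by
      rw [wordWeight_append, wordWeight_append]
      exact mul_le_mul_of_nonneg_left hle (wordWeight_pos hs J).le)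
    have hmem : τ' ∈ wordNeighbours f s A (J ++ σ) := by
      refine ⟨h1, h2, h3, x, hx, wordMap f ρ y, wordMap_mem hAf ρ hy, ?_⟩
      rw [← wordMap_append, hρ, wordMap_append, wordMap_append, wordWeight_append]
      exact hlt
    have h4 : σ <:+ J ++ τ := (hmax σ τ' hmem).trans ⟨ρ, hρ⟩
    rcases List.suffix_or_suffix_of_suffix h4 (List.suffix_append J τ) with h5 | h5
    · exact h h5
    · exact h' h5
  refine ⟨J, wordWeight s J, wordWeight_pos hs J, ?_⟩
  rintro σ τ h h' _ ⟨x, hx, rfl⟩ _ ⟨y, hy, rfl⟩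
  rcases le_total (wordWeight s τ) (wordWeight s σ) with hle | hle
  · rw [max_eq_left hle]
    exact key σ τ h h' hle x hx y hy
  · rw [max_eq_right hle, dist_comm]
    exact key τ σ h' h hle y hy x hx

end Separation

/-! ### Lower bounds for the quantization error -/

section Lower

variable {ι X : Type*} [MetricSpace X] [MeasurableSpace X] [BorelSpace X]

lemma measurable_infEDist_rpow (α : Set X) {r : ℝ} :
    Measurable fun x : X => Metric.infEDist x α ^ r :=
  measurable_infEDist.pow_const r

/-- A point of `α` within `δ / 2 * wordWeight s σ` of the image of `B` can be that close for only
one `σ` in the antichain, by the triangle inequality. At most `n` words are spoiled in this way, and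
each of the others contributes at least `η * (δ / 2) ^ r * Q B`. -/
lemma le_lintegral_infEDist_of_isSeparatingSet {f : ι → X → X} {s : ι → ℝ}
    (hfm : ∀ i, Measurable (f i)) (hs : ∀ i, 0 < s i) {B : Set X} {δ : ℝ} (hδ : 0 < δ)
    (hB : IsSeparatingSet f s B δ) {Γ : Finset (List ι)} (hΓ : IsWordAntichain Γ)
    {m : List ι → ℝ} {P Q : Measure X}
    (hP : ∑ σ ∈ Γ, ENNReal.ofReal (m σ) • Q.map (wordMap f σ) ≤ P) {r η : ℝ} (hr : 0 < r)
    (hη : ∀ σ ∈ Γ, η ≤ m σ * wordWeight s σ ^ r) {n : ℕ} (hn : 2 * n ≤ Γ.card)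
    {α : Finset X} (hα : α.card ≤ n) :
    ENNReal.ofReal (n * η * (δ / 2) ^ r) * Q B ≤
      ∫⁻ x, Metric.infEDist x (α : Set X) ^ r ∂P := by
  classical
  let good : List ι → Prop := fun σ => ∀ x ∈ B, ∀ a ∈ α,
    δ / 2 * wordWeight s σ ≤ dist (wordMap f σ x) a
  have hbad : (Γ.filter fun σ => ¬ good σ).card ≤ n := by
    have hex : ∀ σ ∈ Γ.filter fun σ => ¬ good σ, ∃ a ∈ α, ∃ x ∈ B,
        dist (wordMap f σ x) a < δ / 2 * wordWeight s σ := by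
      intro σ hσ
      have := (Finset.mem_filter.1 hσ).2
      simp only [good] at this
      push Not at this
      obtain ⟨x, hx, a, ha, h⟩ := this
      exact ⟨a, ha, x, hx, h⟩
    rcases isEmpty_or_nonempty X with hX | hX
    · rw [Finset.filter_eq_empty_iff.2 fun σ _ => not_not.2 fun x _ => isEmptyElim x]
      exact Nat.zero_le n
    choose! a ha hax using hex
    refine (Finset.card_le_card_of_injOn a ha ?_).trans hα
    intro σ hσ τ hτ hστ
    obtain ⟨x, hx, h1⟩ := hax σ hσ
    obtain ⟨y, hy, h2⟩ := hax τ hτ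
    by_contra hne
    have hσΓ := (Finset.mem_filter.1 hσ).1
    have hτΓ := (Finset.mem_filter.1 hτ).1
    have h3 := hB σ τ (fun h => hne (hΓ σ hσΓ τ hτΓ h))
      (fun h => hne (hΓ τ hτΓ σ hσΓ h).symm) x hx y hy
    have h4 := dist_triangle_right (wordMap f σ x) (wordMap f τ y) (a σ)
    rw [← hστ] at h2
    have h5 := le_max_left (wordWeight s σ) (wordWeight s τ)
    have h6 := le_max_right (wordWeight s σ) (wordWeight s τ)
    nlinarith
  have hgood : n ≤ (Γ.filter good).card := by
    have := Finset.card_filter_add_card_filter_not (s := Γ) good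
    omega
  have hmeas := measurable_infEDist_rpow (α : Set X) (r := r)
  have hterm : ∀ σ ∈ Γ.filter good, ENNReal.ofReal (η * (δ / 2) ^ r) * Q B ≤
      ∫⁻ x, Metric.infEDist x (α : Set X) ^ r
        ∂(ENNReal.ofReal (m σ) • Q.map (wordMap f σ)) := by
    intro σ hσ
    obtain ⟨hσΓ, hσg⟩ := Finset.mem_filter.1 hσ
    have hsσ := wordWeight_pos hs σ
    rw [lintegral_smul_measure, lintegral_map hmeas (measurable_wordMap hfm σ)]
    have h1 : B ⊆ {x | ENNReal.ofReal ((δ / 2 * wordWeight s σ) ^ r) ≤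
        Metric.infEDist (wordMap f σ x) (α : Set X) ^ r} := by
      intro x hx
      rw [Set.mem_ofPred_eq, ← ENNReal.ofReal_rpow_of_nonneg (by positivity) hr.le]
      refine ENNReal.rpow_le_rpow ?_ hr.le
      rw [Metric.le_infEDist]
      intro a ha
      rw [edist_dist]
      exact ENNReal.ofReal_le_ofReal (hσg x hx a ha)
    have h2 := mul_meas_ge_le_lintegral (μ := Q)
      (hmeas.comp (measurable_wordMap hfm σ)) (ENNReal.ofReal ((δ / 2 * wordWeight s σ) ^ r))
    refine le_trans ?_ (mul_le_mul_right ((mul_le_mul_right (measure_mono h1) _).trans h2) _)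
    rw [← mul_assoc]
    refine mul_le_mul_left ?_ _
    -- The sign of `m σ` is not prescribed; if it is not positive then `η ≤ 0` and the left side
    -- vanishes.
    rcases le_or_gt (m σ) 0 with hm | hm
    · have : η ≤ 0 := (hη σ hσΓ).trans
        (mul_nonpos_of_nonpos_of_nonneg hm (Real.rpow_nonneg hsσ.le r))
      rw [ENNReal.ofReal_eq_zero.2
        (mul_nonpos_of_nonpos_of_nonneg this (Real.rpow_nonneg (by positivity) r))]
      exact zero_le
    · rw [← ENNReal.ofReal_mul hm.le]
      refine ENNReal.ofReal_le_ofReal ?_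
      rw [Real.mul_rpow (by positivity) hsσ.le]
      have := mul_le_mul_of_nonneg_right (hη σ hσΓ)
        (Real.rpow_nonneg (by positivity : 0 ≤ δ / 2) r)
      linarith
  calc ENNReal.ofReal (n * η * (δ / 2) ^ r) * Q B
      = n * (ENNReal.ofReal (η * (δ / 2) ^ r) * Q B) := by
        rw [mul_assoc (n : ℝ), ENNReal.ofReal_mul (Nat.cast_nonneg n), ENNReal.ofReal_natCast,
          mul_assoc]
    _ ≤ ((Γ.filter good).card : ℝ≥0∞) * (ENNReal.ofReal (η * (δ / 2) ^ r) * Q B) :=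
        mul_le_mul_left (by exact_mod_cast hgood) _
    _ = ∑ σ ∈ Γ.filter good, ENNReal.ofReal (η * (δ / 2) ^ r) * Q B := by
        rw [Finset.sum_const, nsmul_eq_mul]
    _ ≤ ∑ σ ∈ Γ.filter good, ∫⁻ x, Metric.infEDist x (α : Set X) ^ r
          ∂(ENNReal.ofReal (m σ) • Q.map (wordMap f σ)) := Finset.sum_le_sum hterm
    _ ≤ ∑ σ ∈ Γ, ∫⁻ x, Metric.infEDist x (α : Set X) ^ r
          ∂(ENNReal.ofReal (m σ) • Q.map (wordMap f σ)) :=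
        Finset.sum_le_sum_of_subset (Finset.filter_subset _ _)
    _ = ∫⁻ x, Metric.infEDist x (α : Set X) ^ r
          ∂(∑ σ ∈ Γ, ENNReal.ofReal (m σ) • Q.map (wordMap f σ)) :=
        (lintegral_finsetSum_measure _ _ _).symm
    _ ≤ _ := lintegral_mono' hP le_rfl

lemma one_sub_inv_exponent {ξ r : ℝ} (hξ : 0 < ξ) :
    1 - 1 / (ξ / (ξ + r)) = -(r / ξ) := by
  field_simp
  ring

/-- Masses `m σ` on cylinders, superadditive in the sense of the measures `Φ σ`, give a lower bound
for the quantization error in terms of the sums of `(m σ * s σ ^ r) ^ u` over antichains. -/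
lemma eventually_le_quantizationError [Fintype ι] {f : ι → X → X} {s : ι → ℝ}
    (hfm : ∀ i, Measurable (f i)) (hs : ∀ i, 0 < s i) {B : Set X} {δ : ℝ} (hδ : 0 < δ)
    (hB : IsSeparatingSet f s B δ) {P Q : Measure X} {m : List ι → ℝ} (hm : ∀ σ, 0 < m σ)
    {Φ : List ι → Measure X} (hΦ : ∀ σ, ∑ i, Φ (i :: σ) ≤ Φ σ) (hΦP : Φ [] ≤ P)
    (hmΦ : ∀ σ, ENNReal.ofReal (m σ) • Q.map (wordMap f σ) ≤ Φ σ)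
    {r ξ κ L : ℝ} (hr : 0 < r) (hξ : 0 < ξ) (hκ : 0 < κ) (hL : 0 < L)
    (hc : ∀ i σ, κ * (m σ * wordWeight s σ ^ r) ≤ m (i :: σ) * wordWeight s (i :: σ) ^ r)
    (hdec : ∀ ε > 0, ∃ K : ℕ, ∀ σ, K ≤ σ.length → m σ * wordWeight s σ ^ r < ε)
    (hsum : ∀ σ, (m σ * wordWeight s σ ^ r) ^ (ξ / (ξ + r)) ≤
      ∑ i, (m (i :: σ) * wordWeight s (i :: σ) ^ r) ^ (ξ / (ξ + r)))
    {Γ₀ : Finset (List ι)} (hΓ₀ : IsRefinement {[]} Γ₀)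
    (hLΓ : L ≤ ∑ σ ∈ Γ₀, (m σ * wordWeight s σ ^ r) ^ (ξ / (ξ + r))) :
    ∀ᶠ n : ℕ in atTop,
      (ENNReal.ofReal (κ * (L / 2) ^ (1 / (ξ / (ξ + r))) * (δ / 2) ^ r) * Q B) ^ (1 / r) ≤
        (n : ℝ≥0∞) ^ (1 / ξ) * quantizationError P r n := by
  set u := ξ / (ξ + r) with hu_def
  have hu : 0 < u := by positivity
  have hcpos : ∀ σ, 0 < m σ * wordWeight s σ ^ r := fun σ =>
    mul_pos (hm σ) (Real.rpow_pos_of_pos (wordWeight_pos hs σ) r)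
  have hanti₀ := hΓ₀.isWordAntichain (isWordAntichain_singleton _)
  have hlim : Tendsto (fun n : ℕ => (L / (2 * n)) ^ (1 / u)) atTop (nhds 0) := by
    have h1 : Tendsto (fun n : ℕ => L / (2 * (n : ℝ))) atTop (nhds 0) :=
      tendsto_const_nhds.div_atTop
        (tendsto_natCast_atTop_atTop.const_mul_atTop (by norm_num : (0 : ℝ) < 2))
    have h2 := h1.rpow_const (p := 1 / u) (Or.inr (by positivity))
    rwa [Real.zero_rpow (by positivity)] at h2
  -- For large `n` all of `Γ₀` lies above the threshold, so the stopped family refines `Γ₀` and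
  -- inherits the lower bound `L`.
  have hsmall : ∀ᶠ n : ℕ in atTop, ∀ σ ∈ Γ₀, (L / (2 * n)) ^ (1 / u) ≤ m σ * wordWeight s σ ^ r := by
    rw [Filter.eventually_all_finset]
    exact fun σ _ => hlim.eventually_le_const (hcpos σ)
  filter_upwards [hsmall, eventually_gt_atTop 0] with n hn hn0
  have hn0' : (0 : ℝ) < n := by exact_mod_cast hn0
  -- Chosen so that `ε ^ u = L / (2 * n)`: stopped words satisfy `c σ < ε`, so a total of at least
  -- `L` requires at least `2 * n` of them.
  set ε := (L / (2 * n)) ^ (1 / u) with hε_def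
  have hε : 0 < ε := by positivity
  obtain ⟨Γ, hΓ, hΓε⟩ := exists_refinement_threshold hκ.le hc (hdec ε hε) hn
  have hanti := hΓ.isWordAntichain hanti₀
  have hcard : 2 * n ≤ Γ.card := by
    have h1 : L ≤ Γ.card * (L / (2 * n)) := by
      calc L ≤ _ := hLΓ
        _ ≤ ∑ σ ∈ Γ, (m σ * wordWeight s σ ^ r) ^ u := hΓ.sum_le hanti₀ hsum
        _ ≤ ∑ σ ∈ Γ, ε ^ u := Finset.sum_le_sum fun σ hσ =>
            Real.rpow_le_rpow (hcpos σ).le (hΓε σ hσ).2.le hu.le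
        _ = Γ.card * (L / (2 * n)) := by
            rw [Finset.sum_const, nsmul_eq_mul, hε_def, ← Real.rpow_mul (by positivity),
              one_div_mul_cancel hu.ne', Real.rpow_one]
    have h2 : (2 * n : ℝ) ≤ Γ.card := by
      rw [← mul_div_assoc, le_div_iff₀ (by positivity), mul_comm L] at h1
      exact le_of_mul_le_mul_right h1 hL
    exact_mod_cast h2
  have hP : ∑ σ ∈ Γ, ENNReal.ofReal (m σ) • Q.map (wordMap f σ) ≤ P := by
    refine (Finset.sum_le_sum fun σ _ => hmΦ σ).trans ?_
    refine (IsRefinement.sum_ge (hΓ₀.trans hΓ) (isWordAntichain_singleton _) hΦ).trans ?_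
    simpa using hΦP
  have hmain : ∀ α : Finset X, 1 ≤ α.card ∧ α.card ≤ n →
      ENNReal.ofReal ((n : ℝ) ^ (-(r / ξ))) *
        (ENNReal.ofReal (κ * (L / 2) ^ (1 / u) * (δ / 2) ^ r) * Q B) ≤
      ∫⁻ x, Metric.infEDist x (α : Set X) ^ r ∂P := by
    intro α hα
    refine le_trans (le_of_eq ?_) (le_lintegral_infEDist_of_isSeparatingSet hfm hs hδ hB hanti hP hr
      (fun σ hσ => (hΓε σ hσ).1) hcard hα.2)
    rw [← mul_assoc, ← ENNReal.ofReal_mul (by positivity)]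
    congr 2
    rw [← one_sub_inv_exponent hξ, ← hu_def, Real.rpow_sub hn0', Real.rpow_one, hε_def,
      Real.div_rpow hL.le (by positivity), Real.div_rpow hL.le (by positivity),
      Real.mul_rpow (by positivity) hn0'.le]
    field_simp
  have hquant : (ENNReal.ofReal ((n : ℝ) ^ (-(r / ξ))) *
        (ENNReal.ofReal (κ * (L / 2) ^ (1 / u) * (δ / 2) ^ r) * Q B)) ^ (1 / r) ≤
      quantizationError P r n := by
    refine le_iInf₂ fun α hα => ?_
    exact ENNReal.rpow_le_rpow (hmain α hα) (by positivity)
  refine le_trans (le_of_eq ?_) (mul_le_mul_right hquant _)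
  generalize ENNReal.ofReal (κ * (L / 2) ^ (1 / u) * (δ / 2) ^ r) * Q B = K
  rw [ENNReal.mul_rpow_of_nonneg _ _ (by positivity), ← mul_assoc,
    ENNReal.ofReal_rpow_of_pos (by positivity), ← Real.rpow_mul hn0'.le, ← ENNReal.ofReal_natCast,
    ENNReal.ofReal_rpow_of_pos hn0', ← ENNReal.ofReal_mul (by positivity), ← Real.rpow_add hn0']
  have : 1 / ξ + -(r / ξ) * (1 / r) = 0 := by field_simp; ring
  rw [this]
  simp

end Lower

/-! ### Positivity and divergence of the lower quantization coefficient -/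

section Cylinders

variable {ι X : Type*} [Fintype ι] [MeasurableSpace X]

lemma sum_map_wordMap_cons_le {f : ι → X → X} (hfm : ∀ i, Measurable (f i)) {w : ι → ℝ}
    {Q : Measure X} (hQ : ∑ i, ENNReal.ofReal (w i) • Q.map (f i) ≤ Q) {c : ℝ} (hc : 0 ≤ c)
    (σ : List ι) :
    ∑ i, ENNReal.ofReal (c * w i) • Q.map (wordMap f (i :: σ)) ≤
      ENNReal.ofReal c • Q.map (wordMap f σ) := by
  have hσ := measurable_wordMap hfm σ
  have h1 : ∀ i, Q.map (wordMap f (i :: σ)) = (Q.map (f i)).map (wordMap f σ) := fun i =>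
    (Measure.map_map hσ (hfm i)).symm
  have h2 : ∑ i, ENNReal.ofReal (c * w i) • Q.map (wordMap f (i :: σ)) =
      ENNReal.ofReal c • (∑ i, ENNReal.ofReal (w i) • Q.map (f i)).map (wordMap f σ) := by
    ext S hS
    rw [Measure.smul_apply, Measure.map_apply hσ hS, Measure.finsetSum_apply,
      Measure.finsetSum_apply, smul_eq_mul, Finset.mul_sum]
    refine Finset.sum_congr rfl fun i _ => ?_
    rw [h1, Measure.smul_apply, Measure.smul_apply, Measure.map_apply hσ hS, smul_eq_mul,
      smul_eq_mul, ENNReal.ofReal_mul hc, mul_assoc]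
  rw [h2]
  refine Measure.le_iff.2 fun S hS => ?_
  simp only [Measure.smul_apply, Measure.map_apply hσ hS, smul_eq_mul]
  exact mul_le_mul_right (hQ _) _

/-- Ensures that the separating set, an image under `wordMap f J`, is charged. The image need not be
measurable, so only the inequality `Measure.le_map_apply` is used. -/
lemma measure_image_wordMap_pos {f : ι → X → X} (hfm : ∀ i, Measurable (f i)) {w : ι → ℝ}
    (hw : ∀ i, 0 < w i) {Q : Measure X} (hQ : ∑ i, ENNReal.ofReal (w i) • Q.map (f i) ≤ Q)
    (σ : List ι) {A : Set X} (hA : 0 < Q A) : 0 < Q (wordMap f σ '' A) := by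
  induction σ generalizing A with
  | nil =>
    have : wordMap f ([] : List ι) '' A = A := Set.image_id A
    rwa [this]
  | cons i σ ih =>
    have h1 : wordMap f (i :: σ) '' A = wordMap f σ '' (f i '' A) := by
      rw [← Set.image_comp]; rfl
    rw [h1]
    refine ih ?_
    have h2 : ENNReal.ofReal (w i) * Q (f i ⁻¹' (f i '' A)) ≤ Q (f i '' A) := by
      calc ENNReal.ofReal (w i) * Q (f i ⁻¹' (f i '' A))
          ≤ ENNReal.ofReal (w i) * Q.map (f i) (f i '' A) :=
            mul_le_mul_right (Measure.le_map_apply (hfm i).aemeasurable _) _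
        _ ≤ ∑ j, ENNReal.ofReal (w j) * Q.map (f j) (f i '' A) :=
            Finset.single_le_sum (f := fun j => ENNReal.ofReal (w j) * Q.map (f j) (f i '' A))
              (fun _ _ => zero_le) (Finset.mem_univ i)
        _ = (∑ j, ENNReal.ofReal (w j) • Q.map (f j)) (f i '' A) := by
            rw [Measure.finsetSum_apply]; rfl
        _ ≤ Q (f i '' A) := hQ _
    refine lt_of_lt_of_le (ENNReal.mul_pos (ENNReal.ofReal_pos.2 (hw i)).ne' ?_) h2
    exact (hA.trans_le (measure_mono (Set.subset_preimage_image _ _))).ne'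

end Cylinders

section LowerCoefficient

variable {ι X : Type*} [Fintype ι] [MetricSpace X] [MeasurableSpace X] [BorelSpace X]

lemma exists_pos_le_lt_one [Nonempty ι] {a : ι → ℝ} (ha : ∀ i, 0 < a i) (ha1 : ∀ i, a i < 1) :
    ∃ κ θ : ℝ, 0 < κ ∧ θ < 1 ∧ ∀ i, κ ≤ a i ∧ a i ≤ θ := by
  obtain ⟨i, hi⟩ := Finite.exists_min a
  obtain ⟨j, hj⟩ := Finite.exists_max a
  exact ⟨a i, a j, ha i, ha1 j, fun k => ⟨hi k, hj k⟩⟩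

lemma exists_length_mul_wordWeight_lt [Nonempty ι] {a : ι → ℝ} (ha : ∀ i, 0 < a i)
    (ha1 : ∀ i, a i < 1) {C ε : ℝ} (hC : 0 < C) (hε : 0 < ε) :
    ∃ K : ℕ, ∀ σ : List ι, K ≤ σ.length → C * wordWeight a σ < ε := by
  obtain ⟨κ, θ, hκ, hθ, h⟩ := exists_pos_le_lt_one ha ha1
  have hθ0 : 0 < θ := hκ.trans_le ((h (Classical.arbitrary ι)).1.trans (h _).2)
  obtain ⟨K, hK⟩ := exists_pow_lt_of_lt_one (div_pos hε hC) hθ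
  refine ⟨K, fun σ hσ => ?_⟩
  have h1 := wordWeight_le_pow ha (fun i => (h i).2) σ
  have h2 := pow_le_pow_of_le_one hθ0.le hθ.le hσ
  rw [mul_comm]
  exact (lt_div_iff₀ hC).1 ((h1.trans h2).trans_lt hK)

/-- With masses `m₀ * wordWeight w σ` the cost is multiplicative along words, and the equation for
`ξ` says that the sum of its `u`-th powers is unchanged by splitting. So `Γ₀ = {[]}` and `L = m₀ ^
u` suffice. -/
lemma lowerQuantizationCoeff_pos_of_isSeparatingSet [Nonempty ι] {f : ι → X → X} {s : ι → ℝ}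
    (hfm : ∀ i, Measurable (f i)) (hs : ∀ i, 0 < s i) (hs1 : ∀ i, s i < 1)
    {B : Set X} {δ : ℝ} (hδ : 0 < δ)
    (hB : IsSeparatingSet f s B δ) {P Q : Measure X} (hQB : 0 < Q B) {w : ι → ℝ}
    (hw : ∀ i, 0 < w i) (hw1 : ∀ i, w i ≤ 1)
    (hQ : ∑ i, ENNReal.ofReal (w i) • Q.map (f i) ≤ Q) {m₀ : ℝ} (hm₀ : 0 < m₀)
    (hP : ENNReal.ofReal m₀ • Q ≤ P) {r ξ : ℝ} (hr : 0 < r)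
    (hξ : IsQuantizationExponent s w r ξ) : 0 < lowerQuantizationCoeff P r ξ := by
  obtain ⟨hξ0, hξ1⟩ := hξ
  have hu : 0 < ξ / (ξ + r) := by positivity
  set a : ι → ℝ := fun i => w i * s i ^ r with ha_def
  have ha : ∀ i, 0 < a i := fun i => mul_pos (hw i) (Real.rpow_pos_of_pos (hs i) r)
  have ha1 : ∀ i, a i < 1 := fun i =>
    mul_lt_one_of_nonneg_of_lt_one_right (hw1 i) (Real.rpow_nonneg (hs i).le r)
      (Real.rpow_lt_one (hs i).le (hs1 i) hr)
  obtain ⟨κ, θ, hκ, hθ, h⟩ := exists_pos_le_lt_one ha ha1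
  have hc : ∀ σ, m₀ * wordWeight w σ * wordWeight s σ ^ r = m₀ * wordWeight a σ := by
    intro σ
    rw [ha_def, wordWeight_mul, wordWeight_rpow hs, mul_assoc]
  have hev := eventually_le_quantizationError (P := P) (Q := Q) (L := m₀ ^ (ξ / (ξ + r)))
    (Γ₀ := {[]}) (m := fun σ => m₀ * wordWeight w σ)
    (Φ := fun σ => ENNReal.ofReal (m₀ * wordWeight w σ) • Q.map (wordMap f σ)) hfm hs hδ hB
    (fun σ => mul_pos hm₀ (wordWeight_pos hw σ)) ?_ ?_ (fun σ => le_rfl) hr hξ0 hκ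
    (Real.rpow_pos_of_pos hm₀ _) ?_ ?_ ?_ Relation.ReflTransGen.refl ?_
  · refine lt_of_lt_of_le ?_ (le_liminf_of_le (by isBoundedDefault) hev)
    refine ENNReal.rpow_pos_of_nonneg (ENNReal.mul_pos ?_ hQB.ne') (by positivity)
    exact (ENNReal.ofReal_pos.2 (by positivity)).ne'
  · intro σ
    refine le_trans (le_of_eq ?_) (sum_map_wordMap_cons_le hfm hQ
      (mul_pos hm₀ (wordWeight_pos hw σ)).le σ)
    refine Finset.sum_congr rfl fun i _ => ?_
    rw [wordWeight_cons]
    congr 2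
    ring
  · have : wordMap f ([] : List ι) = id := rfl
    simpa [this] using hP
  · intro i σ
    simp only [hc]
    rw [wordWeight_cons, mul_left_comm]
    exact mul_le_mul_of_nonneg_left
      (mul_le_mul_of_nonneg_right (h i).1 (wordWeight_pos ha σ).le) hm₀.le
  · intro ε hε
    simp only [hc]
    exact exists_length_mul_wordWeight_lt ha ha1 hm₀ hε
  · intro σ
    simp only [hc]
    simp only [wordWeight_cons]
    have : ∀ i, (m₀ * (a i * wordWeight a σ)) ^ (ξ / (ξ + r)) =
        a i ^ (ξ / (ξ + r)) * (m₀ * wordWeight a σ) ^ (ξ / (ξ + r)) := by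
      intro i
      rw [mul_left_comm, Real.mul_rpow (ha i).le (mul_pos hm₀ (wordWeight_pos ha σ)).le]
    simp only [this]
    rw [← Finset.sum_mul, hξ1, one_mul]
  · simp

end LowerCoefficient

/-! ### Divergence when the two exponents coincide -/

section MixedMass

variable {ι X : Type*}

/-- The mass that the `ν`-terms of the iterated equation `μ = p₀ • ν + ∑ i, p i • μ.map (f i)`
put on the cylinder of a word before the last term is expanded. -/
noncomputable def mixedMass (t p : ι → ℝ) (p₀ : ℝ) : List ι → ℝ
  | [] => 0
  | i :: σ => t i * (mixedMass t p p₀ σ + p₀ * wordWeight p σ)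

lemma mixedMass_nonneg {t p : ι → ℝ} {p₀ : ℝ} (ht : ∀ i, 0 < t i) (hp : ∀ i, 0 < p i)
    (hp₀ : 0 < p₀) (σ : List ι) : 0 ≤ mixedMass t p p₀ σ := by
  induction σ with
  | nil => exact le_rfl
  | cons i σ ih =>
    exact mul_nonneg (ht i).le (add_nonneg ih (mul_pos hp₀ (wordWeight_pos hp σ)).le)

/-- Bounds the masses uniformly, so that the costs decay like the contraction ratios. -/
lemma mixedMass_add_wordWeight_le_one {t p : ι → ℝ} {p₀ : ℝ} (ht : ∀ i, 0 < t i)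
    (ht1 : ∀ i, t i ≤ 1) (hp : ∀ i, 0 < p i) (hp₀ : 0 < p₀) (hp1 : ∀ i, p₀ + p i ≤ 1)
    (σ : List ι) : mixedMass t p p₀ σ + wordWeight p σ ≤ 1 := by
  induction σ with
  | nil => simp [mixedMass]
  | cons i σ ih =>
    rw [mixedMass, wordWeight_cons]
    have h1 := mul_le_mul_of_nonneg_right (ht1 i) (mixedMass_nonneg ht hp hp₀ σ)
    have h2 := mul_le_mul_of_nonneg_right (ht1 i) (mul_pos hp₀ (wordWeight_pos hp σ)).le
    have h3 := mul_le_mul_of_nonneg_right (hp1 i) (wordWeight_pos hp σ).le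
    linarith

/-- Expanding `μ` once on the cylinder of `σ` releases `ν`-mass `p₀ * wordWeight p σ`. Together with
the `ν`-mass already there it is distributed to the children by the self-similarity of `ν`, which is
the recursion defining `mixedMass`. -/
lemma sum_mixedMass_measure_le [Fintype ι] [MeasurableSpace X] {f : ι → X → X}
    (hfm : ∀ i, Measurable (f i)) {t p : ι → ℝ} {p₀ : ℝ} (ht : ∀ i, 0 < t i)
    (hp : ∀ i, 0 < p i) (hp₀ : 0 < p₀) {μ ν : Measure X}
    (hν : ∑ i, ENNReal.ofReal (t i) • ν.map (f i) ≤ ν)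
    (hμ : ENNReal.ofReal p₀ • ν + ∑ i, ENNReal.ofReal (p i) • μ.map (f i) ≤ μ) (σ : List ι) :
    ∑ i, (ENNReal.ofReal (wordWeight p (i :: σ)) • μ.map (wordMap f (i :: σ)) +
        ENNReal.ofReal (mixedMass t p p₀ (i :: σ)) • ν.map (wordMap f (i :: σ))) ≤
      ENNReal.ofReal (wordWeight p σ) • μ.map (wordMap f σ) +
        ENNReal.ofReal (mixedMass t p p₀ σ) • ν.map (wordMap f σ) := by
  have hσ := measurable_wordMap hfm σ
  have hm := mixedMass_nonneg ht hp hp₀ σ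
  have hpσ := wordWeight_pos hp σ
  have h1 : ∀ i (P : Measure X), P.map (wordMap f (i :: σ)) = (P.map (f i)).map (wordMap f σ) :=
    fun i P => (Measure.map_map hσ (hfm i)).symm
  have h2 : ∑ i, ENNReal.ofReal (mixedMass t p p₀ (i :: σ)) • ν.map (wordMap f (i :: σ)) ≤
      ENNReal.ofReal (mixedMass t p p₀ σ + p₀ * wordWeight p σ) • ν.map (wordMap f σ) := by
    refine le_trans (le_of_eq ?_) (sum_map_wordMap_cons_le hfm hν (add_nonneg hm
      (mul_pos hp₀ hpσ).le) σ)
    refine Finset.sum_congr rfl fun i _ => ?_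
    rw [mixedMass, mul_comm]
  have h3 : ENNReal.ofReal (p₀ * wordWeight p σ) • ν.map (wordMap f σ) +
      ∑ i, ENNReal.ofReal (wordWeight p (i :: σ)) • μ.map (wordMap f (i :: σ)) =
      ENNReal.ofReal (wordWeight p σ) • (ENNReal.ofReal p₀ • ν +
        ∑ i, ENNReal.ofReal (p i) • μ.map (f i)).map (wordMap f σ) := by
    ext S hS
    simp only [Measure.add_apply, Measure.smul_apply, Measure.finsetSum_apply, h1,
      Measure.map_apply hσ hS, smul_eq_mul, mul_add, Finset.mul_sum, wordWeight_cons]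
    congr 1
    · rw [mul_comm p₀, ENNReal.ofReal_mul hpσ.le, mul_assoc]
    · refine Finset.sum_congr rfl fun i _ => ?_
      rw [mul_comm (p i), ENNReal.ofReal_mul hpσ.le, mul_assoc]
  have h4 : ENNReal.ofReal (wordWeight p σ) • (ENNReal.ofReal p₀ • ν +
        ∑ i, ENNReal.ofReal (p i) • μ.map (f i)).map (wordMap f σ) ≤
      ENNReal.ofReal (wordWeight p σ) • μ.map (wordMap f σ) := by
    refine Measure.le_iff.2 fun S hS => ?_
    rw [Measure.smul_apply, Measure.smul_apply, Measure.map_apply hσ hS, Measure.map_apply hσ hS]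
    exact mul_le_mul_right (hμ _) _
  rw [Finset.sum_add_distrib]
  refine (add_le_add_right h2 _).trans ?_
  rw [ENNReal.ofReal_add hm (mul_pos hp₀ hpσ).le, add_smul, add_comm (_ • ν.map _), ← add_assoc,
    add_comm (∑ i, _), h3]
  exact add_le_add_left h4 _

/-- Concavity of `x ^ u` at `(k + 1) / k * x` and `(k + 1) * y` with weights `k / (k + 1)` and `1 /
(k + 1)`. It adds one summand to a power-mean inequality for `k` summands. -/
lemma rpow_add_ge {u x y k : ℝ} (hu : 0 ≤ u) (hu1 : u ≤ 1) (hx : 0 ≤ x) (hy : 0 ≤ y)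
    (hk : 0 < k) :
    (k + 1) ^ (u - 1) * (k ^ (1 - u) * x ^ u + y ^ u) ≤ (x + y) ^ u := by
  have hk1 : 0 < k + 1 := by positivity
  have h := (Real.concaveOn_rpow hu hu1).2
    (Set.mem_Ici.2 (by positivity : 0 ≤ (k + 1) / k * x))
    (Set.mem_Ici.2 (by positivity : 0 ≤ (k + 1) * y))
    (by positivity : 0 ≤ k / (k + 1)) (by positivity : 0 ≤ 1 / (k + 1)) (by field_simp)
  simp only [smul_eq_mul] at h
  have e1 : k / (k + 1) * ((k + 1) / k * x) + 1 / (k + 1) * ((k + 1) * y) = x + y := by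
    field_simp
  rw [e1] at h
  refine le_trans (le_of_eq ?_) h
  rw [Real.mul_rpow (by positivity) hx, Real.mul_rpow hk1.le hy, Real.div_rpow hk1.le hk.le,
    Real.rpow_sub hk1, Real.rpow_sub hk, Real.rpow_one, Real.rpow_one]
  field_simp

/-- The sum of `u`-th powers of the summands of `mixedMass` scaled by the contraction ratios. -/
noncomputable def mixedPowerSum (a b : ι → ℝ) (u : ℝ) : List ι → ℝ
  | [] => 1
  | i :: σ => a i ^ u * mixedPowerSum a b u σ + wordWeight b (i :: σ) ^ u

lemma sum_wordWeight_levelWords [Fintype ι] {w : ι → ℝ} (hw : ∑ i, w i = 1) (k : ℕ) :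
    ∑ σ ∈ levelWords ι k, wordWeight w σ = 1 := by
  induction k with
  | zero => simp [levelWords]
  | succ k ih =>
    rw [sum_levelWords_succ]
    simp only [wordWeight_cons, ← Finset.sum_mul, hw, one_mul, ih]

/-- Passing to the next level preserves the old total because `∑ i, a i ^ u = 1`, and adds a new
family of total one because `∑ i, b i ^ u = 1`. -/
lemma sum_mixedPowerSum_levelWords [Fintype ι] {a b : ι → ℝ} {u : ℝ} (hb : ∀ i, 0 < b i)
    (ha1 : ∑ i, a i ^ u = 1) (hb1 : ∑ i, b i ^ u = 1) (k : ℕ) :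
    ∑ σ ∈ levelWords ι k, mixedPowerSum a b u σ = k + 1 := by
  induction k with
  | zero => simp [levelWords, mixedPowerSum]
  | succ k ih =>
    have h1 := sum_wordWeight_levelWords hb1 (k + 1)
    rw [sum_levelWords_succ] at h1 ⊢
    simp only [wordWeight_rpow hb] at h1
    simp only [mixedPowerSum, Finset.sum_add_distrib, h1, ← Finset.sum_mul, ha1, one_mul, ih]
    push_cast
    ring

/-- The power-mean inequality for the `σ.length + 1` summands of `c σ`, built up one letter at a
time. -/
lemma mixedPowerSum_le {a b : ι → ℝ} {u p₀ : ℝ} (hu : 0 ≤ u) (hu1 : u ≤ 1) (ha : ∀ i, 0 < a i)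
    (hb : ∀ i, 0 < b i) (hp₀ : 0 < p₀) {c : List ι → ℝ} (hc0 : c [] = p₀)
    (hc : ∀ i σ, c (i :: σ) = a i * c σ + p₀ * wordWeight b (i :: σ)) (hcpos : ∀ σ, 0 < c σ)
    (σ : List ι) :
    p₀ ^ u * ((σ.length + 1 : ℝ) ^ (u - 1) * mixedPowerSum a b u σ) ≤ c σ ^ u := by
  induction σ with
  | nil => simp [mixedPowerSum, hc0]
  | cons i σ ih =>
    have hk : (0 : ℝ) < σ.length + 1 := by positivity
    have h := rpow_add_ge hu hu1 (mul_pos (ha i) (hcpos σ)).le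
      (mul_pos hp₀ (wordWeight_pos hb (i :: σ))).le hk
    rw [hc]
    refine le_trans ?_ h
    rw [mixedPowerSum, Real.mul_rpow (ha i).le (hcpos σ).le,
      Real.mul_rpow hp₀.le (wordWeight_pos hb _).le, List.length_cons]
    push_cast
    have e : (σ.length + 1 : ℝ) ^ (1 - u) * (σ.length + 1 : ℝ) ^ (u - 1) = 1 := by
      rw [← Real.rpow_add hk]; simp
    have h1 : p₀ ^ u * mixedPowerSum a b u σ ≤ (σ.length + 1 : ℝ) ^ (1 - u) * c σ ^ u := by
      have := mul_le_mul_of_nonneg_left ih (Real.rpow_nonneg hk.le (1 - u))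
      refine le_trans (le_of_eq ?_) this
      linear_combination (-(p₀ ^ u * mixedPowerSum a b u σ)) * e
    have h2 := mul_le_mul_of_nonneg_left h1 (Real.rpow_nonneg (ha i).le u)
    have h3 : (0 : ℝ) ≤ (σ.length + 1 + 1 : ℝ) ^ (u - 1) := by positivity
    have h4 := mul_le_mul_of_nonneg_left
      (add_le_add_left h2 (p₀ ^ u * wordWeight b (i :: σ) ^ u)) h3
    refine le_trans (le_of_eq ?_) (h4.trans (le_of_eq ?_)) <;> ring

lemma lowerQuantizationCoeff_eq_top_of_isSeparatingSet [Fintype ι] [Nonempty ι]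
    [MetricSpace X] [MeasurableSpace X] [BorelSpace X] {f : ι → X → X} {s : ι → ℝ}
    (hfm : ∀ i, Measurable (f i)) (hs : ∀ i, 0 < s i) (hs1 : ∀ i, s i < 1)
    {B : Set X} {δ : ℝ} (hδ : 0 < δ)
    (hB : IsSeparatingSet f s B δ) {t p : ι → ℝ} {p₀ : ℝ} (ht : ∀ i, 0 < t i)
    (ht1 : ∀ i, t i ≤ 1) (hp : ∀ i, 0 < p i) (hp₀ : 0 < p₀) (hp1 : ∀ i, p₀ + p i ≤ 1)
    {μ ν : Measure X} (hνB : 0 < ν B)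
    (hν : ∑ i, ENNReal.ofReal (t i) • ν.map (f i) ≤ ν)
    (hμ : ENNReal.ofReal p₀ • ν + ∑ i, ENNReal.ofReal (p i) • μ.map (f i) ≤ μ)
    {r ξ : ℝ} (hr : 0 < r) (hξt : IsQuantizationExponent s t r ξ)
    (hξp : IsQuantizationExponent s p r ξ) : lowerQuantizationCoeff μ r ξ = ⊤ := by
  obtain ⟨hξ0, hξ1⟩ := hξt
  obtain ⟨-, hξ2⟩ := hξp
  set u := ξ / (ξ + r) with hu_def
  have hu : 0 < u := by positivity
  have hu1 : u ≤ 1 := by rw [hu_def, div_le_one (by positivity)]; linarith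
  set a : ι → ℝ := fun i => t i * s i ^ r with ha_def
  set b : ι → ℝ := fun i => p i * s i ^ r with hb_def
  have hsr : ∀ i, 0 < s i ^ r := fun i => Real.rpow_pos_of_pos (hs i) r
  have hsr1 : ∀ i, s i ^ r < 1 := fun i => Real.rpow_lt_one (hs i).le (hs1 i) hr
  have ha : ∀ i, 0 < a i := fun i => mul_pos (ht i) (hsr i)
  have hb : ∀ i, 0 < b i := fun i => mul_pos (hp i) (hsr i)
  have ha1 : ∀ i, a i < 1 := fun i =>
    mul_lt_one_of_nonneg_of_lt_one_right (ht1 i) (hsr i).le (hsr1 i)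
  obtain ⟨κ, θ, hκ, -, h⟩ := exists_pos_le_lt_one ha ha1
  set m : List ι → ℝ := fun σ => mixedMass t p p₀ σ + p₀ * wordWeight p σ with hm_def
  have hm : ∀ σ, 0 < m σ := fun σ =>
    add_pos_of_nonneg_of_pos (mixedMass_nonneg ht hp hp₀ σ) (mul_pos hp₀ (wordWeight_pos hp σ))
  have hm1 : ∀ σ, m σ ≤ 1 := fun σ => by
    have h1 := mixedMass_add_wordWeight_le_one ht ht1 hp hp₀ hp1 σ
    have h2 : p₀ ≤ 1 := by linarith [hp1 (Classical.arbitrary ι), hp (Classical.arbitrary ι)]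
    have h3 := mul_le_mul_of_nonneg_right h2 (wordWeight_pos hp σ).le
    simp only [hm_def]
    linarith
  have hsσ : ∀ σ : List ι, 0 < wordWeight s σ ^ r := fun σ =>
    Real.rpow_pos_of_pos (wordWeight_pos hs σ) r
  set c : List ι → ℝ := fun σ => m σ * wordWeight s σ ^ r with hc_def
  have hcpos : ∀ σ, 0 < c σ := fun σ => mul_pos (hm σ) (hsσ σ)
  have hcrec : ∀ i σ, c (i :: σ) = a i * c σ + p₀ * wordWeight b (i :: σ) := by
    intro i σ
    rw [hb_def, wordWeight_mul, wordWeight_rpow hs]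
    simp only [hc_def, hm_def, ha_def, mixedMass, wordWeight_cons]
    rw [Real.mul_rpow (hs i).le (wordWeight_pos hs σ).le]
    ring
  have hcle : ∀ i σ, a i * c σ ≤ c (i :: σ) := fun i σ => by
    rw [hcrec]
    linarith [mul_pos hp₀ (wordWeight_pos hb (i :: σ))]
  have hc0 : c [] = p₀ := by simp [hc_def, hm_def, mixedMass]
  -- Starting from level `k` allows `L = p₀ ^ u * (k + 1) ^ u`, which is unbounded in `k`.
  have hev : ∀ k : ℕ, (ENNReal.ofReal (κ * (p₀ ^ u * (k + 1 : ℝ) ^ u / 2) ^ (1 / u) *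
      (δ / 2) ^ r) * ν B) ^ (1 / r) ≤ lowerQuantizationCoeff μ r ξ := by
    intro k
    refine le_liminf_of_le (by isBoundedDefault) ?_
    refine eventually_le_quantizationError (Γ₀ := levelWords ι k) (m := m)
      (Φ := fun σ => ENNReal.ofReal (wordWeight p σ) • μ.map (wordMap f σ) +
        ENNReal.ofReal (mixedMass t p p₀ σ) • ν.map (wordMap f σ)) hfm hs hδ hB hm
      (sum_mixedMass_measure_le hfm ht hp hp₀ hν hμ) ?_ ?_ hr hξ0 hκ (by positivity) ?_ ?_ ?_
      (isRefinement_levelWords k) ?_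
    · have : wordMap f ([] : List ι) = id := rfl
      simp [this, mixedMass]
    · intro σ
      -- The `μ`-part dominates `p₀` times the same multiple of `ν`, so all the mass can be counted
      -- on `ν`.
      have h1 : ENNReal.ofReal p₀ • ν ≤ μ := le_trans (Measure.le_add_right le_rfl) hμ
      have hσ := measurable_wordMap hfm σ
      refine Measure.le_iff.2 fun S hS => ?_
      simp only [hm_def, Measure.add_apply, Measure.smul_apply, Measure.map_apply hσ hS,
        smul_eq_mul]
      rw [ENNReal.ofReal_add (mixedMass_nonneg ht hp hp₀ σ)
        (mul_pos hp₀ (wordWeight_pos hp σ)).le, add_mul, add_comm, mul_comm p₀,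
        ENNReal.ofReal_mul (wordWeight_pos hp σ).le, mul_assoc]
      exact add_le_add_left (mul_le_mul_right (h1 _) _) _
    · exact fun i σ => (mul_le_mul_of_nonneg_right (h i).1 (hcpos σ).le).trans (hcle i σ)
    · intro ε hε
      obtain ⟨K, hK⟩ := exists_length_mul_wordWeight_lt hsr hsr1 one_pos hε
      refine ⟨K, fun σ hσ => lt_of_le_of_lt ?_ (hK σ hσ)⟩
      rw [wordWeight_rpow hs]
      exact mul_le_mul_of_nonneg_right (hm1 σ) (hsσ σ).le
    · intro σ
      calc c σ ^ u = ∑ i, (a i * c σ) ^ u := by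
            simp only [Real.mul_rpow (ha _).le (hcpos σ).le, ← Finset.sum_mul]
            rw [hξ1, one_mul]
        _ ≤ ∑ i, c (i :: σ) ^ u := Finset.sum_le_sum fun i _ =>
            Real.rpow_le_rpow (mul_pos (ha i) (hcpos σ)).le (hcle i σ) hu.le
    · calc p₀ ^ u * (k + 1 : ℝ) ^ u
          = ∑ σ ∈ levelWords ι k, p₀ ^ u * ((k + 1 : ℝ) ^ (u - 1) * mixedPowerSum a b u σ) := by
            rw [← Finset.mul_sum, ← Finset.mul_sum, sum_mixedPowerSum_levelWords hb hξ1 hξ2,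
              Real.rpow_sub (by positivity), Real.rpow_one]
            field_simp
        _ ≤ ∑ σ ∈ levelWords ι k, c σ ^ u := Finset.sum_le_sum fun σ hσ => by
            have := mixedPowerSum_le hu.le hu1 ha hb hp₀ hc0 hcrec hcpos σ
            rwa [length_of_mem_levelWords hσ] at this
  have hlim : Tendsto (fun k : ℕ => (ENNReal.ofReal (κ * (p₀ ^ u * (k + 1 : ℝ) ^ u / 2) ^ (1 / u) *
      (δ / 2) ^ r) * ν B) ^ (1 / r)) atTop (nhds ⊤) := by
    have h1 : Tendsto (fun k : ℕ => κ * (p₀ ^ u * (k + 1 : ℝ) ^ u / 2) ^ (1 / u) *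
        (δ / 2) ^ r) atTop atTop := by
      have h2 : Tendsto (fun k : ℕ => (k + 1 : ℝ)) atTop atTop :=
        tendsto_atTop_add_const_right _ _ tendsto_natCast_atTop_atTop
      have h3 := (tendsto_rpow_atTop hu).comp h2
      have h4 := ((h3.const_mul_atTop (Real.rpow_pos_of_pos hp₀ u)).atTop_div_const two_pos)
      have h5 := (tendsto_rpow_atTop (one_div_pos.2 hu)).comp h4
      exact (h5.const_mul_atTop hκ).atTop_mul_const (Real.rpow_pos_of_pos (half_pos hδ) r)
    have h6 := ENNReal.Tendsto.mul_const (b := ν B) (ENNReal.tendsto_ofReal_atTop.comp h1)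
      (Or.inl ENNReal.top_ne_zero)
    rw [ENNReal.top_mul hνB.ne'] at h6
    have h7 := (ENNReal.continuous_rpow_const (y := 1 / r)).tendsto ⊤ |>.comp h6
    rwa [ENNReal.top_rpow_of_pos (one_div_pos.2 hr)] at h7
  exact top_le_iff.1 (le_of_tendsto' hlim hev)

end MixedMass

/-! ### Upper bounds for the quantization error -/

section Upper

variable {ι X : Type*} [MetricSpace X]

lemma infEDist_le_mul_infEDist {g : X → X} {s : ℝ} (hs : 0 ≤ s)
    (hg : ∀ x y, dist (g x) (g y) = s * dist x y) {α β : Finset X} (hα : α.Nonempty)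
    (hβ : ∀ a ∈ α, g a ∈ β) (x : X) :
    Metric.infEDist (g x) (β : Set X) ≤ ENNReal.ofReal s * Metric.infEDist x (α : Set X) := by
  obtain ⟨a, ha, h⟩ := α.finite_toSet.isCompact.exists_infEDist_eq_edist hα x
  rw [h, edist_dist, ← ENNReal.ofReal_mul hs, ← hg, ← edist_dist]
  exact Metric.infEDist_le_edist_of_mem (hβ a ha)

variable [MeasurableSpace X]

lemma lintegral_infEDist_mono {α β : Finset X} (h : α ⊆ β) {r : ℝ} (hr : 0 ≤ r) (P : Measure X) :
    ∫⁻ x, Metric.infEDist x (β : Set X) ^ r ∂P ≤ ∫⁻ x, Metric.infEDist x (α : Set X) ^ r ∂P :=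
  lintegral_mono fun _ => ENNReal.rpow_le_rpow
    (Metric.infEDist_anti (Finset.coe_subset.2 h)) hr

lemma quantizationError_mul_le {P : Measure X} {r ξ C : ℝ} (hr : 0 < r) (hξ : 0 < ξ) (hC : 0 < C)
    (h : ∀ y : ℝ, 1 ≤ y → ∃ α : Finset X, α.Nonempty ∧ (α.card : ℝ) ≤ y ∧
      ∫⁻ x, Metric.infEDist x (α : Set X) ^ r ∂P ≤ ENNReal.ofReal (C * y ^ (-(r / ξ))))
    {n : ℕ} (hn : 1 ≤ n) :
    (n : ℝ≥0∞) ^ (1 / ξ) * quantizationError P r n ≤ ENNReal.ofReal (C ^ (1 / r)) := by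
  have hn0 : (0 : ℝ) < n := by exact_mod_cast hn
  obtain ⟨α, h1, h2, h3⟩ := h n (by exact_mod_cast hn)
  have h4 : quantizationError P r n ≤ ENNReal.ofReal (C * (n : ℝ) ^ (-(r / ξ))) ^ (1 / r) :=
    (iInf₂_le α ⟨h1.card_pos, by exact_mod_cast h2⟩).trans
      (ENNReal.rpow_le_rpow h3 (by positivity))
  refine (mul_le_mul_right h4 _).trans (le_of_eq ?_)
  rw [ENNReal.ofReal_rpow_of_pos (by positivity), ← ENNReal.ofReal_natCast,
    ENNReal.ofReal_rpow_of_pos hn0, ← ENNReal.ofReal_mul (by positivity),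
    Real.mul_rpow hC.le (by positivity), ← Real.rpow_mul hn0.le, mul_left_comm,
    ← Real.rpow_add hn0]
  have : 1 / ξ + -(r / ξ) * (1 / r) = 0 := by field_simp; ring
  rw [this, Real.rpow_zero, mul_one]

variable [BorelSpace X]

lemma lintegral_map_infEDist_le {g : X → X} (hgm : Measurable g) {s : ℝ} (hs : 0 ≤ s)
    (hg : ∀ x y, dist (g x) (g y) = s * dist x y) {α β : Finset X} (hα : α.Nonempty)
    (hβ : ∀ a ∈ α, g a ∈ β) {r : ℝ} (hr : 0 ≤ r) (P : Measure X) :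
    ∫⁻ x, Metric.infEDist x (β : Set X) ^ r ∂(P.map g) ≤
      ENNReal.ofReal (s ^ r) * ∫⁻ x, Metric.infEDist x (α : Set X) ^ r ∂P := by
  rw [lintegral_map (measurable_infEDist_rpow _) hgm,
    ← lintegral_const_mul _ (measurable_infEDist_rpow _)]
  refine lintegral_mono fun x => ?_
  rw [← ENNReal.ofReal_rpow_of_nonneg hs hr, ← ENNReal.mul_rpow_of_nonneg _ _ hr]
  exact ENNReal.rpow_le_rpow (infEDist_le_mul_infEDist hs hg hα hβ x) hr

variable [Fintype ι]

/-- The errors of finite sets `α i` for `P` bound the error of the union of their images under the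
maps `f i` for `∑ i, w i • P.map (f i)`. -/
lemma exists_finset_sum_map {f : ι → X → X} {s w : ι → ℝ} (hfm : ∀ i, Measurable (f i))
    (hs : ∀ i, 0 ≤ s i) (hf : ∀ i x y, dist (f i x) (f i y) = s i * dist x y)
    (hw : ∀ i, 0 ≤ w i) {r : ℝ} (hr : 0 ≤ r) {P : Measure X} {α : ι → Finset X}
    (hα : ∀ i, (α i).Nonempty) {e : ι → ℝ} (he : ∀ i, 0 ≤ e i)
    (hαe : ∀ i, ∫⁻ x, Metric.infEDist x (α i : Set X) ^ r ∂P ≤ ENNReal.ofReal (e i)) :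
    ∃ β : Finset X, (Nonempty ι → β.Nonempty) ∧ β.card ≤ ∑ i, (α i).card ∧
      ∫⁻ x, Metric.infEDist x (β : Set X) ^ r ∂(∑ i, ENNReal.ofReal (w i) • P.map (f i)) ≤
        ENNReal.ofReal (∑ i, w i * s i ^ r * e i) := by
  classical
  refine ⟨Finset.univ.biUnion fun i => (α i).image (f i), ?_, ?_, ?_⟩
  · rintro ⟨i⟩
    obtain ⟨a, ha⟩ := hα i
    exact ⟨f i a, Finset.mem_biUnion.2 ⟨i, Finset.mem_univ i, Finset.mem_image_of_mem _ ha⟩⟩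
  · exact Finset.card_biUnion_le.trans (Finset.sum_le_sum fun i _ => Finset.card_image_le)
  · rw [lintegral_finsetSum_measure, ENNReal.ofReal_sum_of_nonneg
      (fun i _ => mul_nonneg (mul_nonneg (hw i) (Real.rpow_nonneg (hs i) r)) (he i))]
    refine Finset.sum_le_sum fun i _ => ?_
    rw [lintegral_smul_measure, mul_assoc, ENNReal.ofReal_mul (hw i), smul_eq_mul,
      ENNReal.ofReal_mul (Real.rpow_nonneg (hs i) r)]
    refine mul_le_mul_right ?_ _
    refine (lintegral_map_infEDist_le (hfm i) (hs i) (hf i) (hα i) (fun a ha =>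
      Finset.mem_biUnion.2 ⟨i, Finset.mem_univ i, Finset.mem_image_of_mem _ ha⟩) hr P).trans ?_
    exact mul_le_mul_right (hαe i) _

/-- Take the union of the images of sets chosen at the scales `ε / a i`. Both `(κ * ε) ^ (-u)` and
`D * ε ^ (1 - u)` reproduce themselves under this, with factor `∑ i, a i ^ u ≤ 1`. Scales up to
`κ⁻¹` are admitted because `ε / a i` may exceed one; there a singleton is enough. -/
lemma exists_finset_of_selfSimilar_aux [Nonempty ι] {f : ι → X → X} {s w : ι → ℝ}
    (hfm : ∀ i, Measurable (f i)) (hs : ∀ i, 0 < s i)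
    (hf : ∀ i x y, dist (f i x) (f i y) = s i * dist x y) (hw : ∀ i, 0 < w i)
    {r : ℝ} (hr : 0 < r) {P : Measure X} (hP : P ≤ ∑ i, ENNReal.ofReal (w i) • P.map (f i))
    {x₀ : X} {D : ℝ} (hD : 0 < D)
    (hx₀ : ∫⁻ x, Metric.infEDist x (({x₀} : Finset X) : Set X) ^ r ∂P ≤ ENNReal.ofReal D)
    {u κ θ : ℝ} (hu : 0 < u) (hu1 : u < 1) (hκ : 0 < κ)
    (hκθ : ∀ i, κ ≤ w i * s i ^ r ∧ w i * s i ^ r ≤ θ)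
    (hsum : ∑ i, (w i * s i ^ r) ^ u ≤ 1) (k : ℕ) :
    ∀ ε : ℝ, θ ^ k ≤ ε → 0 < ε → κ * ε ≤ 1 → ∃ α : Finset X, α.Nonempty ∧
      (α.card : ℝ) ≤ (κ * ε) ^ (-u) ∧
      ∫⁻ x, Metric.infEDist x (α : Set X) ^ r ∂P ≤ ENNReal.ofReal (D * ε ^ (1 - u)) := by
  set a : ι → ℝ := fun i => w i * s i ^ r with ha_def
  have ha : ∀ i, 0 < a i := fun i => mul_pos (hw i) (Real.rpow_pos_of_pos (hs i) r)
  have hbase : ∀ ε : ℝ, 1 ≤ ε → κ * ε ≤ 1 → ∃ α : Finset X, α.Nonempty ∧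
      (α.card : ℝ) ≤ (κ * ε) ^ (-u) ∧
      ∫⁻ x, Metric.infEDist x (α : Set X) ^ r ∂P ≤ ENNReal.ofReal (D * ε ^ (1 - u)) := by
    intro ε h1 h2
    refine ⟨{x₀}, Finset.singleton_nonempty x₀, ?_, hx₀.trans (ENNReal.ofReal_le_ofReal ?_)⟩
    · simpa using Real.one_le_rpow_of_pos_of_le_one_of_nonpos
        (mul_pos hκ (one_pos.trans_le h1)) h2 (neg_nonpos.2 hu.le)
    · exact le_mul_of_one_le_right hD.le (Real.one_le_rpow h1 (by linarith))
  induction k with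
  | zero =>
    intro ε h1 _ h2
    exact hbase ε (by simpa using h1) h2
  | succ k ih =>
    intro ε h1 hε h2
    rcases le_or_gt 1 ε with h3 | h3
    · exact hbase ε h3 h2
    have hex : ∀ i, ∃ α : Finset X, α.Nonempty ∧ (α.card : ℝ) ≤ (κ * (ε / a i)) ^ (-u) ∧
        ∫⁻ x, Metric.infEDist x (α : Set X) ^ r ∂P ≤
          ENNReal.ofReal (D * (ε / a i) ^ (1 - u)) := by
      intro i
      have hθ0 : 0 < θ := (ha i).trans_le (hκθ i).2
      refine ih (ε / a i) ?_ (div_pos hε (ha i)) ?_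
      · rw [le_div_iff₀ (ha i)]
        refine le_trans ?_ h1
        rw [pow_succ]
        exact mul_le_mul_of_nonneg_left (hκθ i).2 (pow_pos hθ0 k).le
      · rw [← mul_div_assoc, div_le_one (ha i)]
        exact (mul_le_of_le_one_right hκ.le h3.le).trans (hκθ i).1
    choose α hα hcard herr using hex
    obtain ⟨β, hβ, hβcard, hβerr⟩ := exists_finset_sum_map hfm (fun i => (hs i).le) hf
      (fun i => (hw i).le) hr.le hα
      (fun i => mul_nonneg hD.le (Real.rpow_nonneg (div_pos hε (ha i)).le (1 - u))) herr
    refine ⟨β, hβ inferInstance, ?_, ?_⟩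
    · calc (β.card : ℝ) ≤ ∑ i, ((α i).card : ℝ) := by exact_mod_cast hβcard
        _ ≤ ∑ i, (κ * (ε / a i)) ^ (-u) := Finset.sum_le_sum fun i _ => hcard i
        _ = (∑ i, a i ^ u) * (κ * ε) ^ (-u) := by
            rw [Finset.sum_mul]
            refine Finset.sum_congr rfl fun i _ => ?_
            rw [← mul_div_assoc, Real.div_rpow (mul_pos hκ hε).le (ha i).le,
              Real.rpow_neg (ha i).le]
            field_simp
        _ ≤ 1 * (κ * ε) ^ (-u) := mul_le_mul_of_nonneg_right hsum
            (Real.rpow_nonneg (mul_pos hκ hε).le _)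
        _ = (κ * ε) ^ (-u) := one_mul _
    · refine (lintegral_mono' hP le_rfl).trans (hβerr.trans (ENNReal.ofReal_le_ofReal ?_))
      calc ∑ i, w i * s i ^ r * (D * (ε / a i) ^ (1 - u))
          = (∑ i, a i ^ u) * (D * ε ^ (1 - u)) := by
            rw [Finset.sum_mul]
            refine Finset.sum_congr rfl fun i _ => ?_
            rw [Real.div_rpow hε.le (ha i).le, Real.rpow_sub (ha i), Real.rpow_one]
            have := ha i
            have h4 : 0 < a i ^ u := Real.rpow_pos_of_pos (ha i) u
            change a i * _ = _
            field_simp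
        _ ≤ 1 * (D * ε ^ (1 - u)) := mul_le_mul_of_nonneg_right hsum
            (mul_nonneg hD.le (Real.rpow_nonneg hε.le _))
        _ = D * ε ^ (1 - u) := one_mul _

lemma exists_finset_of_selfSimilar [Nonempty ι] {f : ι → X → X} {s w : ι → ℝ}
    (hfm : ∀ i, Measurable (f i)) (hs : ∀ i, 0 < s i)
    (hf : ∀ i x y, dist (f i x) (f i y) = s i * dist x y) (hw : ∀ i, 0 < w i)
    {r : ℝ} (hr : 0 < r) (hws : ∀ i, w i * s i ^ r < 1)
    {P : Measure X} (hP : P ≤ ∑ i, ENNReal.ofReal (w i) • P.map (f i))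
    {x₀ : X} {D : ℝ} (hD : 0 < D)
    (hx₀ : ∫⁻ x, Metric.infEDist x (({x₀} : Finset X) : Set X) ^ r ∂P ≤ ENNReal.ofReal D)
    {u : ℝ} (hu : 0 < u) (hu1 : u < 1) (hsum : ∑ i, (w i * s i ^ r) ^ u ≤ 1) :
    ∃ C : ℝ, 0 < C ∧ ∀ y : ℝ, 1 ≤ y → ∃ α : Finset X, α.Nonempty ∧ (α.card : ℝ) ≤ y ∧
      ∫⁻ x, Metric.infEDist x (α : Set X) ^ r ∂P ≤ ENNReal.ofReal (C * y ^ (-((1 - u) / u))) := by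
  obtain ⟨κ, θ, hκ, hθ, h⟩ := exists_pos_le_lt_one
    (fun i => mul_pos (hw i) (Real.rpow_pos_of_pos (hs i) r)) hws
  -- The scale `ε = κ⁻¹ * y ^ (-(1 / u))` turns the cardinality bound `(κ * ε) ^ (-u)` into `y`.
  refine ⟨D * κ⁻¹ ^ (1 - u), by positivity, fun y hy => ?_⟩
  have hy0 : 0 < y := one_pos.trans_le hy
  have hyu : 0 < y ^ (-(1 / u)) := Real.rpow_pos_of_pos hy0 _
  obtain ⟨k, hk⟩ := exists_pow_lt_of_lt_one (mul_pos (inv_pos.2 hκ) hyu) hθ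
  have hκε : κ * (κ⁻¹ * y ^ (-(1 / u))) = y ^ (-(1 / u)) := by
    rw [← mul_assoc, mul_inv_cancel₀ hκ.ne', one_mul]
  obtain ⟨α, h1, h2, h3⟩ := exists_finset_of_selfSimilar_aux hfm hs hf hw hr hP hD hx₀ hu hu1 hκ
    h hsum k (κ⁻¹ * y ^ (-(1 / u))) hk.le (mul_pos (inv_pos.2 hκ) hyu) (by
      rw [hκε]
      exact Real.rpow_le_one_of_one_le_of_nonpos hy (neg_nonpos.2 (one_div_pos.2 hu).le))
  refine ⟨α, h1, h2.trans (le_of_eq ?_), h3.trans (ENNReal.ofReal_le_ofReal (le_of_eq ?_))⟩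
  · rw [hκε, ← Real.rpow_mul hy0.le, neg_mul_neg, one_div_mul_cancel hu.ne', Real.rpow_one]
  · rw [Real.mul_rpow (inv_pos.2 hκ).le hyu.le, ← Real.rpow_mul hy0.le, mul_assoc]
    congr 3
    ring

/-- Split the budget `y` into `(1 - l * θ) * y` points for `Q` and `l * b i ^ u * y` for the `i`-th
copy of `P`. The copies then cost at most `θ` times the bound to be proved, and `C` is taken so
large that the `Q`-part fits into the remaining fraction `1 - θ`. Real budgets avoid rounding. -/
lemma exists_finset_of_inhomogeneous {f : ι → X → X} {s w : ι → ℝ}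
    (hfm : ∀ i, Measurable (f i)) (hs : ∀ i, 0 < s i)
    (hf : ∀ i x y, dist (f i x) (f i y) = s i * dist x y) (hw : ∀ i, 0 < w i)
    {w₀ : ℝ} (hw₀ : 0 < w₀) {r : ℝ} (hr : 0 < r) {P Q : Measure X}
    (hP : P ≤ ENNReal.ofReal w₀ • Q + ∑ i, ENNReal.ofReal (w i) • P.map (f i))
    {x₀ : X} {D : ℝ} (hD : 0 < D)
    (hx₀ : ∫⁻ x, Metric.infEDist x (({x₀} : Finset X) : Set X) ^ r ∂P ≤ ENNReal.ofReal D)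
    {u : ℝ} (hu : 0 < u) (hu1 : u < 1) (hsum : ∑ i, (w i * s i ^ r) ^ u < 1)
    {C₀ : ℝ} (hC₀ : 0 < C₀)
    (hQ : ∀ y : ℝ, 1 ≤ y → ∃ α : Finset X, α.Nonempty ∧ (α.card : ℝ) ≤ y ∧
      ∫⁻ x, Metric.infEDist x (α : Set X) ^ r ∂Q ≤
        ENNReal.ofReal (C₀ * y ^ (-((1 - u) / u)))) [Nonempty ι] :
    ∃ C : ℝ, 0 < C ∧ ∀ y : ℝ, 1 ≤ y → ∃ α : Finset X, α.Nonempty ∧ (α.card : ℝ) ≤ y ∧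
      ∫⁻ x, Metric.infEDist x (α : Set X) ^ r ∂P ≤ ENNReal.ofReal (C * y ^ (-((1 - u) / u))) := by
  classical
  set b : ι → ℝ := fun i => w i * s i ^ r with hb_def
  have hb : ∀ i, 0 < b i := fun i => mul_pos (hw i) (Real.rpow_pos_of_pos (hs i) r)
  have hbu : ∀ i, 0 < b i ^ u := fun i => Real.rpow_pos_of_pos (hb i) u
  set θ := ∑ i, b i ^ u with hθ_def
  have hθ0 : 0 < θ := Finset.sum_pos (fun i _ => hbu i) Finset.univ_nonempty
  set γ := (1 - u) / u with hγ_def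
  have hγ : 0 < γ := div_pos (by linarith) hu
  -- Any `l` with `1 ≤ l < 1 / θ` would serve: `l ≥ 1` gives `l ^ (-γ) ≤ 1`, and `l * θ < 1` leaves
  -- points for `Q` and makes the budgets shrink.
  set l := (1 + θ) / (2 * θ) with hl_def
  have hl1 : 1 < l := by rw [hl_def, lt_div_iff₀ (by positivity)]; linarith
  have hl0 : 0 < l := one_pos.trans hl1
  have hlθ : l * θ = (1 + θ) / 2 := by rw [hl_def]; field_simp
  have hρ0 : 0 < 1 - l * θ := by rw [hlθ]; linarith
  -- Above `y₀` every share of the budget is at least one; below it the singleton `{x₀}` is used.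
  obtain ⟨y₀, hy₀1, hy₀b, hy₀ρ⟩ : ∃ y₀ : ℝ, 1 ≤ y₀ ∧ (∀ i, 1 ≤ l * b i ^ u * y₀) ∧
      1 ≤ (1 - l * θ) * y₀ := by
    have h1 : ∀ c : ℝ, 0 < c → ∀ᶠ y : ℝ in atTop, 1 ≤ c * y := fun c hc =>
      (tendsto_id.const_mul_atTop hc).eventually_ge_atTop 1
    exact ((eventually_ge_atTop 1).and ((eventually_all.2 fun i => h1 _ (mul_pos hl0 (hbu i))).and
      (h1 _ hρ0))).exists
  have hy₀0 : 0 < y₀ := one_pos.trans_le hy₀1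
  set C := max (D * y₀ ^ γ) (w₀ * C₀ * (1 - l * θ) ^ (-γ) / (1 - θ)) with hC_def
  have hC : 0 < C := lt_max_of_lt_left (by positivity)
  have key : ∀ k : ℕ, ∀ y : ℝ, 1 ≤ y → (l * θ) ^ k * y ≤ y₀ → ∃ α : Finset X, α.Nonempty ∧
      (α.card : ℝ) ≤ y ∧
      ∫⁻ x, Metric.infEDist x (α : Set X) ^ r ∂P ≤ ENNReal.ofReal (C * y ^ (-γ)) := by
    have hbase : ∀ y : ℝ, 1 ≤ y → y ≤ y₀ → ∃ α : Finset X, α.Nonempty ∧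
        (α.card : ℝ) ≤ y ∧
        ∫⁻ x, Metric.infEDist x (α : Set X) ^ r ∂P ≤ ENNReal.ofReal (C * y ^ (-γ)) := by
      intro y hy hyy
      have hy0 : 0 < y := one_pos.trans_le hy
      refine ⟨{x₀}, Finset.singleton_nonempty x₀, by simpa using hy,
        hx₀.trans (ENNReal.ofReal_le_ofReal ?_)⟩
      rw [Real.rpow_neg hy0.le, ← div_eq_mul_inv, le_div_iff₀ (Real.rpow_pos_of_pos hy0 γ)]
      exact (mul_le_mul_of_nonneg_left (Real.rpow_le_rpow hy0.le hyy hγ.le) hD.le).trans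
        (le_max_left _ _)
    intro k
    induction k with
    | zero =>
      intro y hy h
      exact hbase y hy (by simpa using h)
    | succ k ih =>
      intro y hy h
      rcases le_or_gt y y₀ with hyy | hyy
      · exact hbase y hy hyy
      have hy0 : 0 < y := one_pos.trans_le hy
      have hyi : ∀ i, 1 ≤ l * b i ^ u * y := fun i => (hy₀b i).trans
        (mul_le_mul_of_nonneg_left hyy.le (mul_pos hl0 (hbu i)).le)
      have hyρ : 1 ≤ (1 - l * θ) * y := hy₀ρ.trans (mul_le_mul_of_nonneg_left hyy.le hρ0.le)
      have hex : ∀ i, ∃ α : Finset X, α.Nonempty ∧ (α.card : ℝ) ≤ l * b i ^ u * y ∧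
          ∫⁻ x, Metric.infEDist x (α : Set X) ^ r ∂P ≤
            ENNReal.ofReal (C * (l * b i ^ u * y) ^ (-γ)) := by
        intro i
        refine ih _ (hyi i) (le_trans ?_ h)
        have h1 : b i ^ u ≤ θ :=
          Finset.single_le_sum (f := fun i => b i ^ u) (fun j _ => (hbu j).le) (Finset.mem_univ i)
        rw [pow_succ, mul_assoc ((l * θ) ^ k)]
        refine mul_le_mul_of_nonneg_left ?_ (by positivity)
        exact mul_le_mul_of_nonneg_right (mul_le_mul_of_nonneg_left h1 hl0.le) hy0.le
      choose α hα hcard herr using hex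
      obtain ⟨β, hβ, hβcard, hβerr⟩ := exists_finset_sum_map hfm (fun i => (hs i).le) hf
        (fun i => (hw i).le) hr.le hα (fun i => mul_nonneg hC.le
          (Real.rpow_nonneg (zero_le_one.trans (hyi i)) (-γ))) herr
      obtain ⟨α₀, hα₀, hcard₀, herr₀⟩ := hQ _ hyρ
      refine ⟨α₀ ∪ β, hα₀.mono Finset.subset_union_left, ?_, ?_⟩
      · calc ((α₀ ∪ β).card : ℝ) ≤ α₀.card + ∑ i, ((α i).card : ℝ) := by
              exact_mod_cast (Finset.card_union_le _ _).trans (Nat.add_le_add_left hβcard _)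
          _ ≤ (1 - l * θ) * y + ∑ i, l * b i ^ u * y :=
              add_le_add hcard₀ (Finset.sum_le_sum fun i _ => hcard i)
          _ = y := by rw [← Finset.sum_mul, ← Finset.mul_sum]; ring
      · refine (lintegral_mono' hP le_rfl).trans ?_
        rw [lintegral_add_measure, lintegral_smul_measure, smul_eq_mul]
        refine (add_le_add (mul_le_mul_right ((lintegral_infEDist_mono Finset.subset_union_left
          hr.le Q).trans herr₀) _) ((lintegral_infEDist_mono Finset.subset_union_right hr.le
          _).trans hβerr)).trans ?_
        have hyγ : 0 < y ^ (-γ) := Real.rpow_pos_of_pos hy0 _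
        have hργ : 0 < (1 - l * θ) ^ (-γ) := Real.rpow_pos_of_pos hρ0 _
        have hsum' : ∑ i, w i * s i ^ r * (C * (l * b i ^ u * y) ^ (-γ)) =
            C * y ^ (-γ) * (l ^ (-γ) * θ) := by
          rw [hθ_def, Finset.mul_sum, Finset.mul_sum]
          refine Finset.sum_congr rfl fun i _ => ?_
          rw [Real.mul_rpow (mul_pos hl0 (hbu i)).le hy0.le, Real.mul_rpow hl0.le (hbu i).le,
            ← Real.rpow_mul (hb i).le]
          have h1 : b i * b i ^ (u * -γ) = b i ^ u := by
            nth_rewrite 1 [← Real.rpow_one (b i)]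
            rw [← Real.rpow_add (hb i)]
            congr 1
            rw [hγ_def]
            field_simp
            ring
          rw [← h1]
          change b i * _ = _
          ring
        rw [← ENNReal.ofReal_mul hw₀.le, ← ENNReal.ofReal_add (by positivity)
          (by rw [hsum']; positivity), hsum']
        refine ENNReal.ofReal_le_ofReal ?_
        rw [Real.mul_rpow hρ0.le hy0.le]
        have h1 : w₀ * C₀ * (1 - l * θ) ^ (-γ) ≤ C * (1 - θ) := by
          rw [← div_le_iff₀ (by linarith)]
          exact le_max_right _ _
        have h2 : l ^ (-γ) ≤ 1 :=
          Real.rpow_le_one_of_one_le_of_nonpos hl1.le (neg_nonpos.2 hγ.le)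
        have h3 := mul_le_mul_of_nonneg_right h1 hyγ.le
        have h4 := mul_le_mul_of_nonneg_left (mul_le_of_le_one_left hθ0.le h2)
          (mul_pos hC hyγ).le
        linarith
  refine ⟨C, hC, fun y hy => ?_⟩
  have hy0 : 0 < y := one_pos.trans_le hy
  obtain ⟨k, hk⟩ := exists_pow_lt_of_lt_one (div_pos hy₀0 hy0)
    (by rw [hlθ]; linarith : l * θ < 1)
  exact key k y hy ((lt_div_iff₀ hy0).1 hk).le

end Upper

/-! ### Quantization exponents and dimensions -/

section Exponent

variable {ι : Type*} [Fintype ι]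

lemma exponent_strictMono {r ξ η : ℝ} (hr : 0 < r) (hξ : 0 < ξ) (h : ξ < η) :
    ξ / (ξ + r) < η / (η + r) := by
  rw [div_lt_div_iff₀ (by linarith) (by linarith)]
  nlinarith

lemma sum_rpow_exponent_lt [Nonempty ι] {a : ι → ℝ} (ha : ∀ i, 0 < a i) (ha1 : ∀ i, a i < 1)
    {r ξ η : ℝ} (hr : 0 < r) (hξ : 0 < ξ) (h : ξ < η) :
    ∑ i, a i ^ (η / (η + r)) < ∑ i, a i ^ (ξ / (ξ + r)) :=
  Finset.sum_lt_sum_of_nonempty Finset.univ_nonempty fun i _ =>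
    Real.rpow_lt_rpow_of_exponent_gt (ha i) (ha1 i) (exponent_strictMono hr hξ h)

/-- The map `ξ ↦ ξ / (ξ + r)` is an increasing bijection from the positive reals onto `(0, 1)`, and
`∑ i, a i ^ u` decreases strictly from the number of maps at `u = 0` to a value below one at `u =
1`. -/
lemma existsUnique_isQuantizationExponent {s w : ι → ℝ} (hcard : 2 ≤ Fintype.card ι)
    (hs : ∀ i, 0 < s i) (hs1 : ∀ i, s i < 1) (hw : ∀ i, 0 < w i) (hw1 : ∑ i, w i ≤ 1)
    {r : ℝ} (hr : 0 < r) : ∃! ξ : ℝ, IsQuantizationExponent s w r ξ := by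
  have : Nonempty ι := Fintype.card_pos_iff.1 (by omega)
  set a : ι → ℝ := fun i => w i * s i ^ r with ha_def
  have ha : ∀ i, 0 < a i := fun i => mul_pos (hw i) (Real.rpow_pos_of_pos (hs i) r)
  have haw : ∀ i, a i < w i := fun i =>
    mul_lt_of_lt_one_right (hw i) (Real.rpow_lt_one (hs i).le (hs1 i) hr)
  have ha1 : ∀ i, a i < 1 := fun i => (haw i).trans_le
    ((Finset.single_le_sum (fun j _ => (hw j).le) (Finset.mem_univ i)).trans hw1)
  have hcont : Continuous fun u : ℝ => ∑ i, a i ^ u :=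
    continuous_finsetSum _ fun i _ => Real.continuous_const_rpow (ha i).ne'
  have h0 : 1 < ∑ i, a i ^ (0 : ℝ) := by
    simp only [Real.rpow_zero, Finset.sum_const, Finset.card_univ, nsmul_eq_mul, mul_one]
    exact_mod_cast hcard
  have h1 : ∑ i, a i ^ (1 : ℝ) < 1 := by
    simp only [Real.rpow_one]
    exact (Finset.sum_lt_sum_of_nonempty Finset.univ_nonempty fun i _ => haw i).trans_le hw1
  obtain ⟨u, ⟨hu0, hu1⟩, hu⟩ := intermediate_value_Ioo' zero_le_one hcont.continuousOn
    (Set.mem_Ioo.2 ⟨h1, h0⟩)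
  have hu1' : 0 < 1 - u := by linarith
  have hξ : IsQuantizationExponent s w r (r * u / (1 - u)) := by
    refine ⟨by positivity, ?_⟩
    have : r * u / (1 - u) / (r * u / (1 - u) + r) = u := by
      field_simp
      ring
    rw [this]
    exact hu
  have huniq : ∀ ξ η : ℝ, IsQuantizationExponent s w r ξ → IsQuantizationExponent s w r η →
      ¬ ξ < η := fun ξ η hξ hη hlt =>
    (sum_rpow_exponent_lt ha ha1 hr hξ.1 hlt).ne (hη.2.trans hξ.2.symm)
  exact ⟨_, hξ, fun η hη =>
    le_antisymm (not_lt.1 (huniq _ _ hξ hη)) (not_lt.1 (huniq _ _ hη hξ))⟩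

end Exponent

section Dimension

variable {X : Type*} [MetricSpace X] [MeasurableSpace X]

lemma tendsto_log_div {ξ : ℝ} (hξ : 0 < ξ) (c : ℝ) :
    Tendsto (fun n : ℕ => Real.log n / (1 / ξ * Real.log n - c)) atTop (nhds ξ) := by
  have hlog : Tendsto (fun n : ℕ => Real.log n) atTop atTop :=
    Real.tendsto_log_atTop.comp tendsto_natCast_atTop_atTop
  have h1 : Tendsto (fun n : ℕ => (1 / ξ - c / Real.log n)⁻¹) atTop (nhds ξ) := by
    have h2 : Tendsto (fun n : ℕ => c / Real.log n) atTop (nhds 0) :=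
      tendsto_const_nhds.div_atTop hlog
    have h3 := (tendsto_const_nhds (x := 1 / ξ)).sub h2
    rw [sub_zero] at h3
    have h4 := h3.inv₀ (one_div_pos.2 hξ).ne'
    simpa only [one_div, inv_inv] using h4
  refine h1.congr' ?_
  filter_upwards [hlog.eventually_gt_atTop 0] with n hn
  have h2 : 1 / ξ * Real.log n - c = Real.log n * (1 / ξ - c / Real.log n) := by
    field_simp
  rw [h2, div_mul_eq_div_div, div_self hn.ne']
  exact (one_div _).symm

lemma log_quotient_eq {n : ℕ} (hn : 0 < n) {e : ℝ≥0∞} (he : e ≠ 0) (he' : e ≠ ⊤) :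
    ENNReal.log (n : ℝ≥0∞) / (-ENNReal.log e) =
      ((Real.log n / (-Real.log e.toReal) : ℝ) : EReal) := by
  have h1 : ∀ x : ℝ≥0∞, x ≠ 0 → x ≠ ⊤ → ENNReal.log x = (Real.log x.toReal : EReal) := by
    intro x hx hx'
    exact ENNReal.log_pos_real hx hx'
  rw [h1 e he he', h1 n (by exact_mod_cast hn.ne') (ENNReal.natCast_ne_top n), EReal.coe_div,
    EReal.coe_neg, ENNReal.toReal_natCast]

lemma upperQuantizationDim_le {P : Measure X} {r η : ℝ} (hη : 0 < η)
    (hpos : ∀ᶠ n in atTop, quantizationError P r n ≠ 0)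
    (h : upperQuantizationCoeff P r η < ⊤) : upperQuantizationDim P r ≤ η := by
  obtain ⟨C, hC1, hC2⟩ := ENNReal.lt_iff_exists_nnreal_btwn.1 h
  have hC0 : (0 : ℝ≥0∞) < C := bot_le.trans_lt hC1
  have hC : (0 : ℝ) < C := by exact_mod_cast hC0
  have hev := eventually_lt_of_limsup_lt hC1
  have hden : ∀ᶠ n : ℕ in atTop, 0 < 1 / η * Real.log n - Real.log C := by
    have hlog : Tendsto (fun n : ℕ => 1 / η * Real.log n) atTop atTop :=
      (Real.tendsto_log_atTop.comp tendsto_natCast_atTop_atTop).const_mul_atTop (one_div_pos.2 hη)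
    filter_upwards [hlog.eventually_gt_atTop (Real.log C)] with n hn
    linarith
  have hlim := (EReal.tendsto_coe.2 (tendsto_log_div hη (Real.log C))).limsup_eq
  rw [← hlim]
  refine limsup_le_limsup ?_ (by isBoundedDefault) (by isBoundedDefault)
  filter_upwards [hev, hden, hpos, eventually_ge_atTop 1] with n h1 h2 h3 h4
  have hn : (0 : ℝ) < n := by exact_mod_cast h4
  have hnp : (n : ℝ≥0∞) ^ (1 / η) ≠ 0 :=
    (ENNReal.rpow_pos (by exact_mod_cast h4) (ENNReal.natCast_ne_top n)).ne'
  have he' : quantizationError P r n ≠ ⊤ := by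
    intro htop
    rw [htop, ENNReal.mul_top hnp] at h1
    exact not_top_lt h1
  rw [log_quotient_eq h4 h3 he', EReal.coe_le_coe_iff]
  set x := (quantizationError P r n).toReal with hx_def
  have hx : 0 < x := ENNReal.toReal_pos h3 he'
  have h5 : (n : ℝ) ^ (1 / η) * x ≤ C := by
    have := ENNReal.toReal_mono ENNReal.coe_ne_top h1.le
    rwa [ENNReal.toReal_mul, ← ENNReal.toReal_rpow, ENNReal.toReal_natCast] at this
  have h6 := Real.log_le_log (by positivity) h5
  rw [Real.log_mul (by positivity) hx.ne', Real.log_rpow hn] at h6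
  exact div_le_div_of_nonneg_left (Real.log_natCast_nonneg n) h2 (by linarith)

/-- Take logarithms in `c ≤ n ^ (1 / ξ) * e`. Errors below one keep `-log e` positive, so that the
quotients may be compared. -/
lemma le_lowerQuantizationDim {P : Measure X} {r ξ : ℝ} (hξ : 0 < ξ)
    (hlt : ∀ᶠ n in atTop, quantizationError P r n < 1)
    (h : 0 < lowerQuantizationCoeff P r ξ) : ξ ≤ lowerQuantizationDim P r := by
  obtain ⟨c, hc1, hc2⟩ := ENNReal.lt_iff_exists_nnreal_btwn.1 h
  have hc : (0 : ℝ) < c := by exact_mod_cast hc1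
  have hev := eventually_lt_of_lt_liminf hc2
  have hlim := (EReal.tendsto_coe.2 (tendsto_log_div hξ (Real.log c))).liminf_eq
  rw [← hlim]
  refine liminf_le_liminf ?_ (by isBoundedDefault) (by isBoundedDefault)
  filter_upwards [hev, hlt, eventually_ge_atTop 1] with n h1 h3 h4
  have hn : (0 : ℝ) < n := by exact_mod_cast h4
  have he : quantizationError P r n ≠ 0 := by
    intro h0
    rw [h0, mul_zero] at h1
    exact not_lt_bot h1
  have he' := h3.ne_top
  rw [log_quotient_eq h4 he he', EReal.coe_le_coe_iff]
  set x := (quantizationError P r n).toReal with hx_def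
  have hx : 0 < x := ENNReal.toReal_pos he he'
  have hx1 : x < 1 := by
    have := (ENNReal.toReal_lt_toReal he' ENNReal.one_ne_top).2 h3
    rwa [ENNReal.toReal_one] at this
  have h5 : (c : ℝ) ≤ (n : ℝ) ^ (1 / ξ) * x := by
    have := ENNReal.toReal_mono (ENNReal.mul_ne_top
      (ENNReal.rpow_ne_top_of_nonneg (one_div_pos.2 hξ).le (ENNReal.natCast_ne_top n)) he') h1.le
    rwa [ENNReal.toReal_mul, ← ENNReal.toReal_rpow, ENNReal.toReal_natCast] at this
  have h6 := Real.log_le_log hc h5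
  rw [Real.log_mul (by positivity) hx.ne', Real.log_rpow hn] at h6
  have h7 := Real.log_neg hx hx1
  exact div_le_div_of_nonneg_left (Real.log_natCast_nonneg n) (by linarith) (by linarith)

lemma eventually_quantizationError_lt_one {P : Measure X} {r η : ℝ} (hη : 0 < η)
    (h : upperQuantizationCoeff P r η < ⊤) : ∀ᶠ n in atTop, quantizationError P r n < 1 := by
  obtain ⟨C, hC1, hC2⟩ := ENNReal.lt_iff_exists_nnreal_btwn.1 h
  have hlim : Tendsto (fun n : ℕ => (n : ℝ≥0∞) ^ (1 / η)) atTop (nhds ⊤) :=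
    (ENNReal.tendsto_rpow_at_top (one_div_pos.2 hη)).comp ENNReal.tendsto_nat_nhds_top
  filter_upwards [eventually_lt_of_limsup_lt hC1, hlim.eventually (lt_mem_nhds hC2)] with n h1 h2
  by_contra! h3
  exact absurd ((h2.trans_le (le_mul_of_one_le_right' h3)).trans h1) (lt_irrefl _)

lemma hasQuantizationDim_of_coeff {P : Measure X} {r ξ : ℝ} (hξ : 0 < ξ)
    (hlow : 0 < lowerQuantizationCoeff P r ξ)
    (hup : ∀ η, ξ < η → upperQuantizationCoeff P r η < ⊤) : HasQuantizationDim P r ξ := by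
  have hpos : ∀ᶠ n in atTop, quantizationError P r n ≠ 0 := by
    filter_upwards [eventually_lt_of_lt_liminf hlow] with n hn h0
    rw [h0, mul_zero] at hn
    exact lt_irrefl _ hn
  have h1 : upperQuantizationDim P r ≤ ξ := by
    refine EReal.le_of_forall_lt_iff_le.1 fun η hη => ?_
    have hη' : ξ < η := by exact_mod_cast hη
    exact upperQuantizationDim_le (hξ.trans hη') hpos (hup η hη')
  have h2 : ξ ≤ lowerQuantizationDim P r :=
    le_lowerQuantizationDim hξ (eventually_quantizationError_lt_one (by linarith : 0 < ξ + 1)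
      (hup (ξ + 1) (by linarith))) hlow
  have h3 : lowerQuantizationDim P r ≤ upperQuantizationDim P r :=
    liminf_le_limsup (by isBoundedDefault) (by isBoundedDefault)
  exact ⟨le_antisymm h1 (h2.trans h3), le_antisymm (h3.trans h1) h2⟩

end Dimension

/-! ### Bounded supports -/

section Support

variable {ι E : Type*} [Fintype ι] [NormedAddCommGroup E]

/-- In this form every centred ball of radius at least `R` is mapped into itself by all `f i`. -/
lemma exists_norm_le_of_contracting [Nonempty ι] {f : ι → E → E} {s : ι → ℝ}
    (hf : ∀ i, IsContractiveSimilitude (f i) (s i)) :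
    ∃ θ R : ℝ, 0 < θ ∧ θ < 1 ∧ 0 ≤ R ∧ ∀ i x, ‖f i x‖ ≤ θ * ‖x‖ + (1 - θ) * R := by
  obtain ⟨κ, θ, hκ, hθ, h⟩ := exists_pos_le_lt_one (fun i => (hf i).1) (fun i => (hf i).2.1)
  have hθ0 : 0 < θ := hκ.trans_le ((h (Classical.arbitrary ι)).1.trans (h _).2)
  obtain ⟨j, hj⟩ := Finite.exists_max fun i => ‖f i 0‖
  have hθ1 : 0 < 1 - θ := by linarith
  refine ⟨θ, ‖f j 0‖ / (1 - θ), hθ0, hθ, by positivity, fun i x => ?_⟩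
  rw [mul_div_cancel₀ _ hθ1.ne']
  have h1 := (hf i).2.2 x 0
  rw [dist_eq_norm, dist_zero_right] at h1
  have h2 := norm_sub_norm_le (f i x) (f i 0)
  have h3 := mul_le_mul_of_nonneg_right (h i).2 (norm_nonneg x)
  linarith [hj i]

lemma lintegral_infEDist_singleton_le [MeasurableSpace E] {P : Measure E} [IsProbabilityMeasure P] {R r : ℝ}
    (hR : 0 ≤ R) (hr : 0 ≤ r) (hP : P {x | R < ‖x‖} = 0) :
    ∫⁻ x, Metric.infEDist x (({0} : Finset E) : Set E) ^ r ∂P ≤ ENNReal.ofReal (R ^ r) := by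
  have hae : ∀ᵐ x ∂P, ‖x‖ ≤ R := by
    rw [ae_iff]
    simpa using hP
  calc ∫⁻ x, Metric.infEDist x (({0} : Finset E) : Set E) ^ r ∂P
      ≤ ∫⁻ _, ENNReal.ofReal (R ^ r) ∂P := by
        refine lintegral_mono_ae ?_
        filter_upwards [hae] with x hx
        rw [Finset.coe_singleton, Metric.infEDist_singleton, edist_dist, dist_zero_right,
          ← ENNReal.ofReal_rpow_of_nonneg hR hr]
        exact ENNReal.rpow_le_rpow (ENNReal.ofReal_le_ofReal hx) hr
    _ = ENNReal.ofReal (R ^ r) := by simp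

variable [MeasurableSpace E] [BorelSpace E]

lemma measurable_of_isContractiveSimilitude {g : E → E} {s : ℝ}
    (hg : IsContractiveSimilitude g s) : Measurable g :=
  (LipschitzWith.of_dist_le_mul (K := ⟨s, hg.1.le⟩) fun x y => (hg.2.2 x y).le).continuous.measurable

/-- The preimage of `S k` under each `f i` lies in `S (k + 1)`, so self-similarity gives `ν (S k) ≤
ν (S (k + 1))`. But the sets decrease to the empty set, so `ν (S 0) = 0`. -/
lemma measure_norm_gt_of_selfSimilar {f : ι → E → E} (hfm : ∀ i, Measurable (f i)) {θ R : ℝ}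
    (hθ : 0 < θ) (hθ1 : θ < 1) (hf : ∀ i x, ‖f i x‖ ≤ θ * ‖x‖ + (1 - θ) * R) {t : ι → ℝ}
    (ht : ∀ i, 0 ≤ t i) (ht1 : ∑ i, t i = 1) {ν : Measure E} (hν : IsSelfSimilarMeasure f t ν) :
    ν {x | R + 1 < ‖x‖} = 0 := by
  obtain ⟨hprob, hν⟩ := hν
  set S : ℕ → Set E := fun k => {x | R + θ⁻¹ ^ k < ‖x‖} with hS_def
  have hSm : ∀ k, MeasurableSet (S k) := fun k => measurableSet_lt measurable_const measurable_norm
  have hstep : ∀ k, ν (S k) ≤ ν (S (k + 1)) := by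
    intro k
    have hpre : ∀ i, ν (f i ⁻¹' S k) ≤ ν (S (k + 1)) := by
      refine fun i => measure_mono fun x hx => ?_
      have h1 : R + θ⁻¹ ^ k < ‖f i x‖ := hx
      have h2 := h1.trans_le (hf i x)
      change R + θ⁻¹ ^ (k + 1) < ‖x‖
      have h3 : θ * (R + θ⁻¹ ^ (k + 1)) < θ * ‖x‖ := by
        rw [pow_succ, mul_add, mul_left_comm, mul_inv_cancel₀ hθ.ne']
        linarith
      exact lt_of_mul_lt_mul_left h3 hθ.le
    calc ν (S k) = ∑ i, ENNReal.ofReal (t i) * ν (f i ⁻¹' S k) := by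
          conv_lhs => rw [hν]
          rw [Measure.finsetSum_apply]
          refine Finset.sum_congr rfl fun i _ => ?_
          rw [Measure.smul_apply, Measure.map_apply (hfm i) (hSm k), smul_eq_mul]
      _ ≤ ∑ i, ENNReal.ofReal (t i) * ν (S (k + 1)) :=
          Finset.sum_le_sum fun i _ => mul_le_mul_right (hpre i) _
      _ = ν (S (k + 1)) := by
          rw [← Finset.sum_mul, ← ENNReal.ofReal_sum_of_nonneg (fun i _ => ht i), ht1,
            ENNReal.ofReal_one, one_mul]
  have hle : ∀ k, ν (S 0) ≤ ν (S k) := fun k => monotone_nat_of_le_succ hstep (Nat.zero_le k)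
  have hθ' : 1 < θ⁻¹ := (one_lt_inv₀ hθ).2 hθ1
  have hanti : Antitone S := fun k l hkl x (hx : R + θ⁻¹ ^ l < ‖x‖) =>
    lt_of_le_of_lt (add_le_add_right (pow_le_pow_right₀ hθ'.le hkl) R) hx
  have hempty : ⋂ k, S k = ∅ := by
    refine Set.eq_empty_of_forall_notMem fun x hx => ?_
    obtain ⟨k, hk⟩ := pow_unbounded_of_one_lt (‖x‖ - R) hθ'
    have : R + θ⁻¹ ^ k < ‖x‖ := Set.mem_iInter.1 hx k
    linarith
  have hlim := tendsto_measure_iInter_atTop (μ := ν) (fun k => (hSm k).nullMeasurableSet) hanti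
    ⟨0, measure_ne_top ν _⟩
  rw [hempty, measure_empty] at hlim
  have h0 : ν (S 0) = 0 := le_antisymm (ge_of_tendsto' hlim hle) zero_le
  simpa [hS_def] using h0

/-- As the ball is invariant and `ν` does not charge its complement, `μ S ≤ (1 - p₀) * μ S`, which
forces `μ S = 0`. -/
lemma measure_norm_gt_of_inhomogeneous {f : ι → E → E} (hfm : ∀ i, Measurable (f i)) {R : ℝ}
    (hf : ∀ i x, ‖x‖ ≤ R → ‖f i x‖ ≤ R) {p : ι → ℝ} {p₀ : ℝ}
    (hp : ∀ i, 0 ≤ p i) (hp₀ : 0 < p₀) (hp1 : p₀ + ∑ i, p i = 1) {μ ν : Measure E}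
    (hν : ν {x | R < ‖x‖} = 0) (hμ : IsInhomogeneousSelfSimilarMeasure f p₀ p ν μ) :
    μ {x | R < ‖x‖} = 0 := by
  obtain ⟨hprob, hμ⟩ := hμ
  set S : Set E := {x | R < ‖x‖} with hS_def
  have hSm : MeasurableSet S := measurableSet_lt measurable_const measurable_norm
  have hpre : ∀ i, μ (f i ⁻¹' S) ≤ μ S := by
    refine fun i => measure_mono fun x hx => ?_
    by_contra hx'
    exact absurd (hf i x (not_lt.1 hx')) (not_le.2 hx)
  have h1 : μ S ≤ ENNReal.ofReal (1 - p₀) * μ S := by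
    calc μ S = ∑ i, ENNReal.ofReal (p i) * μ (f i ⁻¹' S) := by
          conv_lhs => rw [hμ]
          rw [Measure.add_apply, Measure.smul_apply, hν, smul_zero, zero_add,
            Measure.finsetSum_apply]
          refine Finset.sum_congr rfl fun i _ => ?_
          rw [Measure.smul_apply, Measure.map_apply (hfm i) hSm, smul_eq_mul]
      _ ≤ ∑ i, ENNReal.ofReal (p i) * μ S :=
          Finset.sum_le_sum fun i _ => mul_le_mul_right (hpre i) _
      _ = ENNReal.ofReal (1 - p₀) * μ S := by
          rw [← Finset.sum_mul, ← ENNReal.ofReal_sum_of_nonneg (fun i _ => hp i),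
            ← hp1, add_sub_cancel_left]
  by_contra hne
  have h2 : ENNReal.ofReal (1 - p₀) * μ S < 1 * μ S :=
    (ENNReal.mul_lt_mul_iff_left hne (measure_ne_top μ S)).2
      (by rw [ENNReal.ofReal_lt_one]; linarith)
  rw [one_mul] at h2
  exact absurd h1 (not_le.2 h2)

end Support

/-- Finiteness of upper quantization coefficients of in-homogeneous self-similar measures. -/
lemma upperQuantizationCoeff_lt_top {ι X : Type*} [Fintype ι] [Nonempty ι] [MetricSpace X]
    [MeasurableSpace X] [BorelSpace X] {f : ι → X → X} {s t p : ι → ℝ} {p₀ : ℝ}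
    (hfm : ∀ i, Measurable (f i)) (hf : ∀ i, IsContractiveSimilitude (f i) (s i))
    (ht : ∀ i, 0 < t i) (ht1 : ∀ i, t i ≤ 1) (hp : ∀ i, 0 < p i) (hp₀ : 0 < p₀)
    {μ ν : Measure X} (hν : IsSelfSimilarMeasure f t ν)
    (hμ : IsInhomogeneousSelfSimilarMeasure f p₀ p ν μ) {r : ℝ} (hr : 0 < r) {x₀ : X} {D : ℝ}
    (hD : 0 < D)
    (hDν : ∫⁻ x, Metric.infEDist x (({x₀} : Finset X) : Set X) ^ r ∂ν ≤ ENNReal.ofReal D)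
    (hDμ : ∫⁻ x, Metric.infEDist x (({x₀} : Finset X) : Set X) ^ r ∂μ ≤ ENNReal.ofReal D)
    {η : ℝ} (hη : 0 < η) (hηt : ∑ i, (t i * s i ^ r) ^ (η / (η + r)) ≤ 1)
    (hηp : ∑ i, (p i * s i ^ r) ^ (η / (η + r)) < 1) : upperQuantizationCoeff μ r η < ⊤ := by
  have hs : ∀ i, 0 < s i := fun i => (hf i).1
  have hu : 0 < η / (η + r) := by positivity
  have hu1 : η / (η + r) < 1 := by rw [div_lt_one (by positivity)]; linarith
  obtain ⟨C₀, hC₀, h₀⟩ := exists_finset_of_selfSimilar hfm hs (fun i => (hf i).2.2) ht hr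
    (fun i => mul_lt_one_of_nonneg_of_lt_one_right (ht1 i) (Real.rpow_nonneg (hs i).le r)
      (Real.rpow_lt_one (hs i).le (hf i).2.1 hr)) hν.2.le hD hDν hu hu1 hηt
  obtain ⟨C, hC, h⟩ := exists_finset_of_inhomogeneous hfm hs (fun i => (hf i).2.2) hp hp₀ hr
    hμ.2.le hD hDμ hu hu1 hηp hC₀ h₀
  have he : (1 - η / (η + r)) / (η / (η + r)) = r / η := by
    field_simp
    ring
  rw [he] at h
  refine lt_of_le_of_lt (limsup_le_of_le (by isBoundedDefault)
    ((eventually_ge_atTop 1).mono fun n hn => quantizationError_mul_le hr hη hC h hn))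
    ENNReal.ofReal_lt_top

theorem theorem1p2 (q N : ℕ) (hN : 2 ≤ N)
    (f : Fin N → EuclideanSpace ℝ (Fin q) → EuclideanSpace ℝ (Fin q)) (s : Fin N → ℝ)
    (hf : ∀ i, IsContractiveSimilitude (f i) (s i))
    (hOSC : OpenSetCondition f)
    (t : Fin N → ℝ) (ht : ∀ i, 0 < t i) (ht1 : ∑ i, t i = 1)
    (p₀ : ℝ) (p : Fin N → ℝ) (hp₀ : 0 < p₀) (hp : ∀ i, 0 < p i) (hp1 : p₀ + ∑ i, p i = 1)
    (ν μ : MeasureTheory.Measure (EuclideanSpace ℝ (Fin q)))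
    (hν : IsSelfSimilarMeasure f t ν)
    (hμ : IsInhomogeneousSelfSimilarMeasure f p₀ p ν μ)
    (r : ℝ) (hr : 0 < r) :
    (∃! ξ : ℝ, IsQuantizationExponent s t r ξ) ∧
    (∃! ξ : ℝ, IsQuantizationExponent s p r ξ) ∧
    ∀ ξ₁ ξ₂ : ℝ, IsQuantizationExponent s t r ξ₁ → IsQuantizationExponent s p r ξ₂ →
      HasQuantizationDim μ r (max ξ₁ ξ₂) ∧
      0 < lowerQuantizationCoeff μ r (max ξ₁ ξ₂) ∧
      (ξ₁ > ξ₂ → upperQuantizationCoeff μ r (max ξ₁ ξ₂) < ⊤) ∧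
      (ξ₁ = ξ₂ → lowerQuantizationCoeff μ r (max ξ₁ ξ₂) = ⊤) := by
  have hNe : Nonempty (Fin N) := ⟨⟨0, by omega⟩⟩
  have hs : ∀ i, 0 < s i := fun i => (hf i).1
  have hs1 : ∀ i, s i < 1 := fun i => (hf i).2.1
  have ht_le : ∀ i, t i ≤ 1 := fun i =>
    (Finset.single_le_sum (fun j _ => (ht j).le) (Finset.mem_univ i)).trans ht1.le
  have hp_le : ∀ i, p₀ + p i ≤ 1 := fun i => by
    have := Finset.single_le_sum (fun j _ => (hp j).le) (Finset.mem_univ i)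
    linarith
  have hcard : 2 ≤ Fintype.card (Fin N) := by simpa using hN
  refine ⟨existsUnique_isQuantizationExponent hcard hs hs1 ht ht1.le hr,
    existsUnique_isQuantizationExponent hcard hs hs1 hp (by linarith) hr, ?_⟩
  intro ξ₁ ξ₂ hξ₁ hξ₂
  have hfm : ∀ i, Measurable (f i) := fun i => measurable_of_isContractiveSimilitude (hf i)
  have hνprob := hν.1
  have hμprob := hμ.1
  obtain ⟨θ, R, hθ, hθ1, hR, hfR⟩ := exists_norm_le_of_contracting hf
  have hinv : ∀ i x, ‖x‖ ≤ R + 1 → ‖f i x‖ ≤ R + 1 := fun i x hx => by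
    have := hfR i x
    nlinarith
  have hν0 := measure_norm_gt_of_selfSimilar hfm hθ hθ1 hfR (fun i => (ht i).le) ht1 hν
  have hμ0 := measure_norm_gt_of_inhomogeneous hfm hinv (fun i => (hp i).le) hp₀ hp1 hν0 hμ
  have hDν := lintegral_infEDist_singleton_le (by linarith : 0 ≤ R + 1) hr.le hν0
  have hDμ := lintegral_infEDist_singleton_le (by linarith : 0 ≤ R + 1) hr.le hμ0
  have hD : 0 < (R + 1) ^ r := Real.rpow_pos_of_pos (by linarith) r
  have hbpos : ∀ P : Measure (EuclideanSpace ℝ (Fin q)), IsProbabilityMeasure P →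
      P {x | R + 1 < ‖x‖} = 0 → 0 < P (Metric.closedBall 0 (R + 1)) := by
    intro P hP h0
    have hc : (Metric.closedBall (0 : EuclideanSpace ℝ (Fin q)) (R + 1))ᶜ =
        {x | R + 1 < ‖x‖} := by
      ext x
      simp
    rw [← hc, prob_compl_eq_zero_iff measurableSet_closedBall] at h0
    rw [h0]
    exact one_pos
  obtain ⟨J, δ, hδ, hB⟩ := exists_separating_word hf hOSC
    (Metric.isBounded_closedBall (x := (0 : EuclideanSpace ℝ (Fin q))) (r := R + 1))
    (fun i x hx => mem_closedBall_zero_iff.2 (hinv i x (mem_closedBall_zero_iff.1 hx)))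
  have hνsub : ∑ i, ENNReal.ofReal (t i) • ν.map (f i) ≤ ν := hν.2.ge
  have hμge : ENNReal.ofReal p₀ • ν + ∑ i, ENNReal.ofReal (p i) • μ.map (f i) ≤ μ := hμ.2.ge
  have hμsub : ∑ i, ENNReal.ofReal (p i) • μ.map (f i) ≤ μ :=
    le_trans (Measure.le_add_left le_rfl) hμge
  have hνμ : ENNReal.ofReal p₀ • ν ≤ μ := le_trans (Measure.le_add_right le_rfl) hμge
  have hνB := measure_image_wordMap_pos hfm ht hνsub J (hbpos ν hνprob hν0)
  have hμB := measure_image_wordMap_pos hfm hp hμsub J (hbpos μ hμprob hμ0)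
  -- Each exponent gives a lower bound by itself: `ξ₁` through `p₀ • ν ≤ μ`, and `ξ₂` through the
  -- cylinder masses of `μ`.
  have hlow : 0 < lowerQuantizationCoeff μ r (max ξ₁ ξ₂) := by
    rcases max_choice ξ₁ ξ₂ with h | h
    · rw [h]
      exact lowerQuantizationCoeff_pos_of_isSeparatingSet hfm hs hs1 hδ hB hνB ht ht_le hνsub hp₀
        hνμ hr hξ₁
    · rw [h]
      exact lowerQuantizationCoeff_pos_of_isSeparatingSet hfm hs hs1 hδ hB hμB hp
        (fun i => by linarith [hp_le i]) hμsub one_pos (by simp) hr hξ₂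
  have hsum_lt : ∀ {w : Fin N → ℝ} {ξ η : ℝ}, (∀ i, 0 < w i) → (∀ i, w i ≤ 1) →
      IsQuantizationExponent s w r ξ → ξ < η → ∑ i, (w i * s i ^ r) ^ (η / (η + r)) < 1 := by
    intro w ξ η hw hw1 hξ hlt
    rw [← hξ.2]
    exact sum_rpow_exponent_lt (fun i => mul_pos (hw i) (Real.rpow_pos_of_pos (hs i) r))
      (fun i => mul_lt_one_of_nonneg_of_lt_one_right (hw1 i) (Real.rpow_nonneg (hs i).le r)
        (Real.rpow_lt_one (hs i).le (hs1 i) hr)) hr hξ.1 hlt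
  have hp_le' : ∀ i, p i ≤ 1 := fun i => by linarith [hp_le i]
  -- Equality is allowed for the `t`-sum but not for the `p`-sum, which is why `η = ξ₁` is
  -- admissible only when `ξ₂ < ξ₁`.
  have hup : ∀ η, 0 < η → ∑ i, (t i * s i ^ r) ^ (η / (η + r)) ≤ 1 → ξ₂ < η →
      upperQuantizationCoeff μ r η < ⊤ := fun η hη hηt hlt =>
    upperQuantizationCoeff_lt_top hfm hf ht ht_le hp hp₀ hν hμ hr hD hDν hDμ hη hηt
      (hsum_lt hp hp_le' hξ₂ hlt)
  refine ⟨hasQuantizationDim_of_coeff (lt_max_of_lt_left hξ₁.1) hlow fun η hη => ?_, hlow, ?_, ?_⟩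
  · have h1 := (le_max_left ξ₁ ξ₂).trans_lt hη
    exact hup η (hξ₁.1.trans h1) (hsum_lt ht ht_le hξ₁ h1).le ((le_max_right ξ₁ ξ₂).trans_lt hη)
  · intro h
    rw [max_eq_left h.le]
    exact hup ξ₁ hξ₁.1 hξ₁.2.le h
  · rintro rfl
    rw [max_self]
    exact lowerQuantizationCoeff_eq_top_of_isSeparatingSet hfm hs hs1 hδ hB ht ht_le hp hp₀ hp_le
      hνB hνsub hμge hr hξ₁ hξ₂
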